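/- **Notation.** A spinor is a vector $\kappa=(\xi,\eta)\in\mathbb C^2$ (a column), and for spinors $\kappa_i=(\xi_i,\eta_i)$ put $\{\kappa_1,\kappa_2\}=\det\begin{pmatrix}\xi_1&\xi_2\\ \eta_1&\eta_2\end{pmatrix}=\xi_1\eta_2-\xi_2\eta_1$. Minkowski space $\mathbb R^{1,3}$ has coordinates $(T,X,Y,Z)$ and form $\langle p,p'\rangle=TT'-XX'-YY'-ZZ'$. Hyperbolic 3-space is used in the hyperboloid model $\mathbb H=\{x:\langle x,x\rangle=1,\ T>0\}$, the conformal ball model $\mathbb D$, and the upper half space model $\mathbb U=\{(x,y,z):z>0\}$ with boundary $\mathbb C\cup\{\infty\}$. The isometry $\mathbb H\to\mathbb D$ is $(T,X,Y,Z)\mapsto (X,Y,Z)/(1+T)$, and the isometry $\mathbb D\to\mathbb U$ is the one extending the map $(x,y,z)\mapsto (x+yi)/(1-z)$ of boundary spheres. $SL(2,\mathbb C)$ acts on $\mathbb U$ by isometries; on $\mathbb R^{1,3}$, identified with the Hermitian matrices by the map $\mathbf g$ below, the action is $S\mapsto ASA^*$, and on the boundary it is by Möbius transformations. **Decorated horospheres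 from spinors.** For $\kappa=(\xi,\eta)\neq0$ let $\mathbf f(\kappa)=\kappa\kappa^*$ and $\mathcal Z(\kappa)=(i\bar\eta,-i\bar\xi)$, let $D_\kappa\mathbf f(\nu)=\kappa\nu^*+\nu\kappa^*$ be the derivative of $\mathbf f$ at $\kappa$ in the direction $\nu$, and let $\mathbf g$ be the linear map $\begin{pmatrix}a&b+ci\\ b-ci&d\end{pmatrix}\mapsto(a+d,2b,2c,a-d)$ from Hermitian matrices to $\mathbb R^{1,3}$. Put $p=\mathbf g(\mathbf f(\kappa))$ and $v=\mathbf g(D_\kappa\mathbf f(\mathcal Z(\kappa)))$, and let $V$ be the plane spanned by $p$ and $v$, with $V/\mathbb Rp$ oriented by $v$. On the horosphere $\{x\in\mathbb H:\langle x,p\rangle=1\}$, the intersections of $V$ with the tangent planes of the horosphere form an oriented line field. Let $\mathbf K(\kappa)$ be the image in $\mathbb U$ of this horosphere with this oriented line field. **Spin decorations.** A frame on $\mathbb U$ is a right-handed orthonormal triple of tangent vectors at a point. The space of spin frames is the double (universal) cover of the space of frames, identified with $SL(2,\mathbb C)$ so that $A\in SL(2,\mathbb C)$ lies over the image under $A$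 of the frame $(e_z,e_y,-e_x)$ at $(0,0,1)$. A path of isometries starting at the identity lifts to $SL(2,\mathbb C)$ and so acts on spin frames; in particular one may rotate a spin frame by an angle about an axis, and translate it along a geodesic, with rotation by $2\pi$ acting as $-1$. A tangent vector field on a horosphere is called parallel if it is invariant under all parabolic isometries preserving the horosphere. A spin decoration on a horosphere $h$ is a pair $W=(W^{in},W^{out})$ of continuous fields of spin frames along $h$ such that, for some unit parallel tangent vector field $\mathcal V$ on $h$, $W^{out}$ lifts the frame field $(N,\mathcal V,N\times\mathcal V)$, where $N$ is the unit normal pointing towards the centre of $h$, $W^{in}$ lifts $(-N,\mathcal V,-N\times\mathcal V)$, and $W^{in}$ is obtained from $W^{out}$ by rotation by $\pi$ about $\mathcal V$ (right-handed). The spin-decorated horosphere $(h,W)$ projects to $h$ together with the line field directed by $\mathcal V$. Let $\widetilde{\mathbf K}$ be a continuous lift of $\mathbf K$ (defined on $\mathbb C^2\setminus\{0\}$) to spin-decorated horospheres, where continuity means that the spin frames $W^{in},W^{out}$ of $\widetilde{\mathbf K}(\kappa)$ at a point $q$ of the horosphere depend continuously on $(\kappa,q)$. **Complex lambda length.** If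 two spin frames $F_1,F_2$ are adapted to an oriented geodesic $\gamma$ (their base points lie on $\gamma$ and their first vectors are positively tangent to $\gamma$), the complex distance from $F_1$ to $F_2$ is the $d=\rho+i\theta$, well defined modulo $4\pi i$, such that translating $F_1$ along $\gamma$ by signed distance $\rho$ and rotating it (right-handed) about $\gamma$ by the angle $\theta$ gives $F_2$. Let $(h_1,W_1),(h_2,W_2)$ be spin-decorated horospheres with centres $p_1,p_2$. If $p_1\neq p_2$, let $\gamma_{12}$ be the oriented geodesic from $p_1$ to $p_2$, let $q_i=\gamma_{12}\cap h_i$, and let $d$ be the complex distance along $\gamma_{12}$ from $W_1^{in}(q_1)$ to $W_2^{out}(q_2)$; the complex lambda length from $(h_1,W_1)$ to $(h_2,W_2)$ is $\lambda_{12}=\exp(d/2)$. If $p_1=p_2$, then $\lambda_{12}=0$. **Theorem.** A continuous lift $\widetilde{\mathbf K}$ of $\mathbf K$ exists, and for every such lift and all nonzero spinors $\kappa_1,\kappa_2$, the complex lambda length from $\widetilde{\mathbf K}(\kappa_1)$ to $\widetilde{\mathbf K}(\kappa_2)$ is well defined and $$\lambda_{12}=\{\kappa_1,\kappa_2\}=\xi_1\eta_2-\xi_2\eta_1.$$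 -/

import Mathlib

open Matrix

namespace SpinHoro

noncomputable section

/-! ### Ambient spaces -/

/-- Spinors `κ = (ξ, η)`, with `ξ = κ 0` and `η = κ 1`. -/
abbrev Spinor := Fin 2 → ℂ

/-- Minkowski space `ℝ^{1,3}` with coordinates `(T, X, Y, Z)`. -/
abbrev Mink := Fin 4 → ℝ

/-- The space `ℝ³` containing both the conformal ball and the upper half space. -/
abbrev Space := Fin 3 → ℝ

/-- The group `SL(2, ℂ)`. -/
abbrev SL2C := Matrix.SpecialLinearGroup (Fin 2) ℂ

/-- The real vector space of `2 × 2` Hermitian matrices. -/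
abbrev Herm := selfAdjoint (Matrix (Fin 2) (Fin 2) ℂ)

/-- The determinant `{κ₁, κ₂} = ξ₁ η₂ - ξ₂ η₁`. -/
def spinorDet (κ₁ κ₂ : Spinor) : ℂ := κ₁ 0 * κ₂ 1 - κ₂ 0 * κ₁ 1

theorem spinorDet_eq_det (κ₁ κ₂ : Spinor) :
    spinorDet κ₁ κ₂ = (!![κ₁ 0, κ₂ 0; κ₁ 1, κ₂ 1] : Matrix (Fin 2) (Fin 2) ℂ).det := by
  simp [spinorDet, Matrix.det_fin_two]

/-! ### Spinors to Hermitian matrices -/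

/-- `f(κ) = κ κ*`. -/
def f (κ : Spinor) : Herm :=
  ⟨vecMulVec κ (star κ), by
    rw [selfAdjoint.mem_iff, star_eq_conjTranspose, conjTranspose_vecMulVec, star_star]⟩

/-- The real derivative of `f` at `κ` in the direction `ν`, namely `κ ν* + ν κ*`. -/
def Df (κ ν : Spinor) : Herm :=
  ⟨vecMulVec κ (star ν) + vecMulVec ν (star κ), by
    rw [selfAdjoint.mem_iff, star_eq_conjTranspose, conjTranspose_add, conjTranspose_vecMulVec,
      conjTranspose_vecMulVec, star_star, star_star, add_comm]⟩

/-- `Df κ ν` is the directional derivative of `f` at `κ` in the direction `ν`. -/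
theorem hasDerivAt_f (κ ν : Spinor) (a b : Fin 2) :
    HasDerivAt (fun s : ℝ => (f (κ + s • ν) : Matrix (Fin 2) (Fin 2) ℂ) a b)
      ((Df κ ν : Matrix (Fin 2) (Fin 2) ℂ) a b) 0 := by
  have h : ∀ c : Fin 2, HasDerivAt (fun s : ℝ => κ c + (s : ℂ) * ν c) (ν c) 0 := fun c => by
    simpa using ((Complex.ofRealCLM.hasDerivAt (x := (0 : ℝ))).mul_const (ν c)).const_add (κ c)
  have h2 : ∀ c : Fin 2, HasDerivAt (fun s : ℝ => star (κ c + (s : ℂ) * ν c)) (star (ν c)) 0 :=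
    fun c => (h c).star
  have h3 := (h a).mul (h2 b)
  simp only [Complex.ofReal_zero, zero_mul, add_zero] at h3
  refine (h3.congr_deriv ?_).congr_of_eventuallyEq (Filter.Eventually.of_forall fun s => ?_)
  · simp [Df, vecMulVec_apply]; ring
  · simp [f, vecMulVec_apply]

/-- `Z(ξ, η) = (i η̄, -i ξ̄)`. -/
def Zmap (κ : Spinor) : Spinor := ![Complex.I * star (κ 1), -Complex.I * star (κ 0)]

/-! ### Flags -/

/-- A pointed oriented flag in a real vector space: a vector `point`, a plane `plane` containing
it, and an orientation of the quotient `plane / ℝ point`, recorded as the set `pos` of those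
vectors of the plane that represent positive elements of the quotient. -/
structure Flag (E : Type) [AddCommGroup E] [Module ℝ E] where
  point : E
  plane : Submodule ℝ E
  pos : Set E

/-- The flag `[[p, v]]` whose plane is spanned by `p` and `v`, with `plane / ℝ p` oriented
by `v`. -/
def Flag.ofPair {E : Type} [AddCommGroup E] [Module ℝ E] (p v : E) : Flag E where
  point := p
  plane := Submodule.span ℝ {p, v}
  pos := {w | ∃ a b : ℝ, 0 < b ∧ w = a • p + b • v}

/-- The image of a flag under a linear map. -/
def Flag.map {E E' : Type} [AddCommGroup E] [Module ℝ E] [AddCommGroup E'] [Module ℝ E']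
    (φ : E →ₗ[ℝ] E') (F : Flag E) : Flag E' where
  point := φ F.point
  plane := F.plane.map φ
  pos := φ '' F.pos

/-- `F(κ) = [[f(κ), D_κ f(Z(κ))]]`. -/
def flagF (κ : Spinor) : Flag Herm := Flag.ofPair (f κ) (Df κ (Zmap κ))

/-- The isomorphism `g` from Hermitian matrices to Minkowski space, sending
`[[a, b + c i], [b - c i, d]]` to `(a + d, 2 b, 2 c, a - d)`. -/
def g : Herm →ₗ[ℝ] Mink where
  toFun S := ![(S.1 0 0).re + (S.1 1 1).re, 2 * (S.1 0 1).re, 2 * (S.1 0 1).im,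
    (S.1 0 0).re - (S.1 1 1).re]
  map_add' S S' := by
    ext k; fin_cases k <;> simp <;> ring
  map_smul' c S := by
    ext k; fin_cases k <;> simp <;> ring

/-- The inverse of `g`, as a matrix. -/
def gInv (v : Mink) : Matrix (Fin 2) (Fin 2) ℂ :=
  !![((v 0 + v 3) / 2 : ℂ), ((v 1 + v 2 * Complex.I) / 2 : ℂ);
    ((v 1 - v 2 * Complex.I) / 2 : ℂ), ((v 0 - v 3) / 2 : ℂ)]

theorem gInv_isSelfAdjoint (v : Mink) : gInv v ∈ selfAdjoint (Matrix (Fin 2) (Fin 2) ℂ) := by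
  rw [selfAdjoint.mem_iff]
  ext a b
  fin_cases a <;> fin_cases b <;> simp [gInv, sub_eq_add_neg]

theorem g_gInv (v : Mink) : g ⟨gInv v, gInv_isSelfAdjoint v⟩ = v := by
  ext k; fin_cases k <;> simp [g, gInv] <;> ring

theorem gInv_g (S : Herm) : gInv (g S) = S.1 := by
  have h := S.2
  rw [selfAdjoint.mem_iff] at h
  have h0 : star (S.1 0 0) = S.1 0 0 := congrFun (congrFun h 0) 0
  have h1 : star (S.1 1 1) = S.1 1 1 := congrFun (congrFun h 1) 1
  have h2 : star (S.1 0 1) = S.1 1 0 := congrFun (congrFun h 1) 0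
  have h0i := Complex.conj_eq_iff_im.1 h0
  have h1i := Complex.conj_eq_iff_im.1 h1
  have h2r := congrArg Complex.re h2
  have h2i := congrArg Complex.im h2
  simp only [Complex.star_def, Complex.conj_re, Complex.conj_im] at h2r h2i
  ext a b
  fin_cases a <;> fin_cases b <;> apply Complex.ext <;>
    simp [gInv, g, h0i, h1i, ← h2r, ← h2i]
  ring

/-- The map `G` on flags induced by `g`. -/
def flagG (F : Flag Herm) : Flag Mink := F.map g

/-! ### The hyperboloid model and line fields -/

/-- The Minkowski form `T T' - X X' - Y Y' - Z Z'`. -/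
def mform (v w : Mink) : ℝ := v 0 * w 0 - v 1 * w 1 - v 2 * w 2 - v 3 * w 3

/-- The positive light cone. -/
def lightCone : Set Mink := {p | mform p p = 0 ∧ 0 < p 0}

/-- The hyperboloid model of hyperbolic 3-space. -/
def hyperboloid : Set Mink := {x | mform x x = 1 ∧ 0 < x 0}

/-- The horosphere `h(p)` in the hyperboloid model. -/
def horoH (p : Mink) : Set Mink := {x | x ∈ hyperboloid ∧ mform x p = 1}

/-- The tangent space at `x` to the horosphere `h(p)`: the Minkowski orthogonal complement of
`x` and `p`. -/
def horoTangentH (p x : Mink) : Set Mink := {v | mform x v = 0 ∧ mform p v = 0}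

/-- A surface with an oriented line field: at each point `x`, `dir x` is the set of positively
directed vectors of the oriented line at `x`. -/
structure LineFieldOn (E : Type) where
  carrier : Set E
  dir : E → Set E

/-- The image under `φ`: the line field is pushed forward by the derivative of `φ`. -/
def LineFieldOn.map {E E' : Type} [NormedAddCommGroup E] [NormedSpace ℝ E]
    [NormedAddCommGroup E'] [NormedSpace ℝ E'] (φ : E → E') (L : LineFieldOn E) :
    LineFieldOn E' where
  carrier := φ '' L.carrier
  dir y := {w | ∃ x ∈ L.carrier, φ x = y ∧ ∃ v ∈ L.dir x, fderiv ℝ φ x v = w}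

/-- The map `H` from flags `(p, V, o)` to decorated horospheres: on the horosphere `h(p)`, the
line field whose line at `x` is the intersection of `V` with the tangent space of the horosphere,
oriented by `o`. -/
def flagH (F : Flag Mink) : LineFieldOn Mink where
  carrier := horoH F.point
  dir x := {v | v ∈ F.plane ∧ v ∈ horoTangentH F.point x ∧ v ∈ F.pos}

/-! ### The conformal ball and upper half space models -/

/-- The isometry `i` from the hyperboloid to the conformal ball, `(X, Y, Z) / (1 + T)`. -/
def iMap (v : Mink) : Space := ![v 1 / (1 + v 0), v 2 / (1 + v 0), v 3 / (1 + v 0)]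

/-- The inverse of `iMap`. -/
def iInv (x : Space) : Mink :=
  ![(1 + x ⬝ᵥ x) / (1 - x ⬝ᵥ x), 2 * x 0 / (1 - x ⬝ᵥ x), 2 * x 1 / (1 - x ⬝ᵥ x),
    2 * x 2 / (1 - x ⬝ᵥ x)]

/-- The isometry `j` from the conformal ball to the upper half space
`{(x, y, z) | 0 < z}`, extending the stereographic projection `(x + y i) / (1 - z)` of the
boundary spheres. -/
def jMap (x : Space) : Space :=
  let D := x 0 ^ 2 + x 1 ^ 2 + (1 - x 2) ^ 2
  ![2 * x 0 / D, 2 * x 1 / D, (1 - x ⬝ᵥ x) / D]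

/-- The inverse of `jMap`. -/
def jInv (x : Space) : Space :=
  let D := x 0 ^ 2 + x 1 ^ 2 + (x 2 + 1) ^ 2
  ![2 * x 0 / D, 2 * x 1 / D, (x ⬝ᵥ x - 1) / D]

theorem iInv_iMap (v : Mink) (hv : v ∈ hyperboloid) : iInv (iMap v) = v := by
  obtain ⟨h1, h2⟩ := hv
  simp only [mform] at h1
  have h3 : (1 + v 0) ≠ 0 := by positivity
  have h4 : iMap v ⬝ᵥ iMap v = (v 0 - 1) / (1 + v 0) := by
    simp only [iMap, dotProduct, Fin.sum_univ_three]
    simp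
    field_simp
    nlinarith
  have h5 : 1 - (v 0 - 1) / (1 + v 0) = 2 / (1 + v 0) := by field_simp; ring
  have h6 : 1 + (v 0 - 1) / (1 + v 0) = 2 * v 0 / (1 + v 0) := by field_simp; ring
  simp only [iInv, h4, h5, h6]
  ext k
  fin_cases k <;> simp [iMap] <;> field_simp

theorem jInv_jMap (x : Space) (hx : x ⬝ᵥ x < 1) : jInv (jMap x) = x := by
  simp only [dotProduct, Fin.sum_univ_three] at hx
  have hD : 0 < x 0 ^ 2 + x 1 ^ 2 + (1 - x 2) ^ 2 := by
    have : x 2 < 1 := by nlinarith [sq_nonneg (x 0), sq_nonneg (x 1)]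
    have := sub_pos.2 this
    positivity
  set D := x 0 ^ 2 + x 1 ^ 2 + (1 - x 2) ^ 2 with hDdef
  have h0 : jMap x 0 = 2 * x 0 / D := by simp [jMap, hDdef]
  have h1 : jMap x 1 = 2 * x 1 / D := by simp [jMap, hDdef]
  have h2 : jMap x 2 = (1 - (x 0 * x 0 + x 1 * x 1 + x 2 * x 2)) / D := by
    simp [jMap, hDdef, dotProduct, Fin.sum_univ_three]
  have h2b : jMap x 2 + 1 = 2 * (1 - x 2) / D := by
    rw [h2, div_add_one hD.ne']; congr 1; rw [hDdef]; ring
  have hE : jMap x 0 ^ 2 + jMap x 1 ^ 2 + (jMap x 2 + 1) ^ 2 = 4 / D := by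
    rw [h0, h1, h2b]; field_simp; rw [hDdef]; ring
  have h3 : jMap x ⬝ᵥ jMap x - 1 = 4 * x 2 / D := by
    have : jMap x ⬝ᵥ jMap x - 1 = (jMap x 0 ^ 2 + jMap x 1 ^ 2 + (jMap x 2 + 1) ^ 2)
        - 2 * (jMap x 2 + 1) := by
      simp only [dotProduct, Fin.sum_univ_three]; ring
    rw [this, hE, h2b]; field_simp; ring
  simp only [jInv]
  rw [hE, h3, h0, h1]
  ext k
  fin_cases k <;> simp <;> field_simp <;> ring

/-- The decorated horosphere `K(κ) = J(I(H(G(F(κ)))))` in the upper half space model. -/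
def K (κ : Spinor) : LineFieldOn Space :=
  LineFieldOn.map jMap (LineFieldOn.map iMap (flagH (flagG (flagF κ))))

/-! ### The action of `SL(2, ℂ)` -/

/-- The action of `A` on Minkowski space, `v ↦ g(A g⁻¹(v) A*)`. -/
def actM (A : SL2C) (v : Mink) : Mink :=
  g ⟨A.1 * gInv v * A.1ᴴ, by
    rw [selfAdjoint.mem_iff, star_eq_conjTranspose, conjTranspose_mul, conjTranspose_mul,
      conjTranspose_conjTranspose, ← star_eq_conjTranspose (gInv v),
      selfAdjoint.mem_iff.1 (gInv_isSelfAdjoint v), Matrix.mul_assoc]⟩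

/-- The action of `A` by an isometry of the upper half space. -/
def act (A : SL2C) (x : Space) : Space := jMap (iMap (actM A (iInv (jInv x))))

/-- The derivative of the isometry `act A` at `x`. -/
def dact (A : SL2C) (x : Space) : Space →L[ℝ] Space := fderiv ℝ (act A) x

open Classical in
/-- The action of `A` on the boundary `ℂ ∪ {∞}` by Möbius transformations. -/
def actBoundary (A : SL2C) (z : OnePoint ℂ) : OnePoint ℂ :=
  (Matrix.SpecialLinearGroup.toGL A) • z

/-- The base point `p₀ = (0, 0, 1)` of the upper half space. -/
def basePt : Space := ![0, 0, 1]

/-- The screw motion `(x, y, h) ↦ (e^d (x + y i), e^{Re d} h)`: translation by `Re d` along the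
upward vertical geodesic together with rotation by `Im d` about it. -/
def screw (d : ℂ) (x : Space) : Space :=
  ![(Complex.exp d * (x 0 + x 1 * Complex.I)).re, (Complex.exp d * (x 0 + x 1 * Complex.I)).im,
    Real.exp d.re * x 2]

/-- The oriented geodesic `γ_A`, parametrised by arc length, running from `A • 0` to `A • ∞`: the
image under `A` of the upward vertical geodesic. -/
def geod (A : SL2C) (t : ℝ) : Space := act A ![0, 0, Real.exp t]

/-- `B` is the spin isometry given by translating by `Re d` along `γ_A` and rotating by `Im d`
about it: the end of the path in `SL(2, ℂ)` that starts at the identity and lifts the path of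
isometries which translate by `t Re d` and rotate by `t Im d`, for `t` from `0` to `1`. -/
def IsSpinScrew (A : SL2C) (d : ℂ) (B : SL2C) : Prop :=
  ∃ M : unitInterval → SL2C, Continuous M ∧ M 0 = 1 ∧ M 1 = B ∧
    ∀ (t : unitInterval) (x : Space), 0 < x 2 →
      act (M t) x = act A (screw (((t : ℝ) : ℂ) * d) (act A⁻¹ x))

/-! ### Frames and spin frames

A right-handed orthonormal frame on hyperbolic space consists of a base point and three tangent
vectors there. The group of orientation preserving isometries acts simply transitively on frames,
and its universal (double) cover `SL(2, ℂ)` acts simply transitively on spin frames, so, having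
chosen a lift of the base frame `(e_z, e_y, -e_x)` at `p₀`, we identify the space of spin frames
with `SL(2, ℂ)`. -/

/-- A frame in the upper half space: a point and three tangent vectors. -/
@[ext]
structure Frame where
  pt : Space
  e1 : Space
  e2 : Space
  e3 : Space

/-- The projection from spin frames to frames: the spin frame `A` lies over the image under `A`
of the base frame. -/
def frameOf (A : SL2C) : Frame where
  pt := act A basePt
  e1 := dact A basePt ![0, 0, 1]
  e2 := dact A basePt ![0, 1, 0]
  e3 := dact A basePt ![-1, 0, 0]

/-- `v` is a unit vector at `q` in the hyperbolic metric of the upper half space. -/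
def IsUnitAt (q v : Space) : Prop := v ⬝ᵥ v = (q 2) ^ 2

/-- The cross product of tangent vectors at `q` in the hyperbolic metric. -/
def hcross (q v w : Space) : Space := (q 2)⁻¹ • (v ⨯₃ w)

/-- The spin frame `s'` is obtained from `s` by rotating by the angle `θ` (right-handed) about
the unit vector `v` at `q`. -/
def IsSpinRotation (q v : Space) (θ : ℝ) (s s' : SL2C) : Prop :=
  ∃ A B : SL2C, act A basePt = q ∧ dact A basePt ![0, 0, 1] = v ∧
    IsSpinScrew A (θ * Complex.I) B ∧ s' = B * s

/-! ### Horospheres and spin decorations -/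

/-- A horosphere in the upper half space. -/
structure Horosphere where
  carrier : Set Space
  isHoro : ∃ p ∈ lightCone, carrier = (fun x => jMap (iMap x)) '' horoH p

/-- The point of the light cone representing the horosphere. -/
def Horosphere.cone (h : Horosphere) : Mink := h.isHoro.choose

open Classical in
/-- The point of `ℂ ∪ {∞}` where the ray of the light cone through `p` meets the boundary: the
image of the boundary point `(X, Y, Z) / T` of the ball under `(x + y i) / (1 - z)`. -/
def boundaryPt (p : Mink) : OnePoint ℂ :=
  if p 3 / p 0 = 1 then OnePoint.infty
  else (((((p 1 / p 0 : ℝ) : ℂ) + ((p 2 / p 0 : ℝ) : ℂ) * Complex.I) /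
    (1 - ((p 3 / p 0 : ℝ) : ℂ)) : ℂ) : OnePoint ℂ)

/-- The centre of a horosphere. -/
def Horosphere.centre (h : Horosphere) : OnePoint ℂ := boundaryPt h.cone

/-- The tangent space of the horosphere at `q`. -/
def Horosphere.tangent (h : Horosphere) (q : Space) : Set Space :=
  (fderiv ℝ (fun x => jMap (iMap x)) (iInv (jInv q))) '' horoTangentH h.cone (iInv (jInv q))

/-- `n` is the outward unit normal of `h` at `q`: it is a unit vector, orthogonal to `h`, and the
geodesic from `q` in the direction `n` tends to the centre of `h`. -/
def Horosphere.IsOutwardNormal (h : Horosphere) (q n : Space) : Prop :=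
  IsUnitAt q n ∧ (∀ v ∈ h.tangent q, n ⬝ᵥ v = 0) ∧
    ∃ A : SL2C, act A basePt = q ∧ dact A basePt ![0, 0, 1] = n ∧
      actBoundary A OnePoint.infty = h.centre

/-- `V` is a unit parallel tangent vector field on `h`: it is invariant under all parabolic
isometries (and the identity) preserving `h`. -/
def Horosphere.IsUnitParallel (h : Horosphere) (V : h.carrier → Space) : Prop :=
  (∀ q : h.carrier, V q ∈ h.tangent q ∧ IsUnitAt q (V q)) ∧
  ∀ A : SL2C, (A.1.trace = 2 ∨ A.1.trace = -2) → act A '' h.carrier = h.carrier →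
    ∀ q q' : h.carrier, act A q = q' → V q' = dact A q (V q)

/-- A spin-decorated horosphere: a horosphere with continuous fields `Win`, `Wout` of spin frames
lifting the inward and outward frame fields of a unit parallel vector field `V`, such that
`Win` is obtained from `Wout` by rotating by `π` about `V`. -/
structure SpinDecoratedHorosphere extends Horosphere where
  Win : carrier → SL2C
  Wout : carrier → SL2C
  continuous_Win : Continuous Win
  continuous_Wout : Continuous Wout
  isSpinDecoration : ∃ V : carrier → Space, toHorosphere.IsUnitParallel V ∧
    ∀ q : carrier, ∃ N : Space, toHorosphere.IsOutwardNormal q N ∧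
      frameOf (Wout q) = ⟨q, N, V q, hcross q N (V q)⟩ ∧
      frameOf (Win q) = ⟨q, -N, V q, hcross q (-N) (V q)⟩ ∧
      IsSpinRotation q (V q) Real.pi (Wout q) (Win q)

/-- `Kt` is a continuous lift of `K` to spin-decorated horospheres: `Kt κ` projects to the
decorated horosphere `K κ`, and its spin frames depend continuously on `κ` and on the point of
the horosphere. -/
structure IsSpinLift (Kt : {κ : Spinor // κ ≠ 0} → SpinDecoratedHorosphere) : Prop where
  carrier_eq : ∀ κ, (Kt κ).carrier = (K κ.1).carrier
  dir_eq : ∀ (κ) (q : (Kt κ).carrier) (w : Space), w ∈ (K κ.1).dir q ↔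
    ∃ c : ℝ, 0 < c ∧ w = c • (frameOf ((Kt κ).Wout q)).e2
  continuous_Wout : Continuous
    (fun z : {z : {κ : Spinor // κ ≠ 0} × Space // z.2 ∈ (Kt z.1).carrier} =>
      (Kt z.1.1).Wout ⟨z.1.2, z.2⟩)
  continuous_Win : Continuous
    (fun z : {z : {κ : Spinor // κ ≠ 0} × Space // z.2 ∈ (Kt z.1).carrier} =>
      (Kt z.1.1).Win ⟨z.1.2, z.2⟩)

/-! ### Complex distance and complex lambda length -/

/-- The spin frame `s` is adapted to the oriented geodesic `γ_A`: its base point lies on `γ_A` and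
its first vector is the positive unit tangent of `γ_A`. -/
def IsAdapted (A s : SL2C) : Prop :=
  ∃ t : ℝ, (frameOf s).pt = geod A t ∧ (frameOf s).e1 = deriv (geod A) t

/-- `d` is a complex distance from `s₁` to `s₂`, both adapted to `γ_A`: translating `s₁` along
`γ_A` by `Re d` and rotating about `γ_A` by `Im d` gives `s₂`. It is determined modulo `4πi`. -/
def IsComplexDistance (A s₁ s₂ : SL2C) (d : ℂ) : Prop :=
  IsAdapted A s₁ ∧ IsAdapted A s₂ ∧ ∃ B : SL2C, IsSpinScrew A d B ∧ s₂ = B * s₁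

/-- `l` is the complex lambda length from `H₁` to `H₂`: it is `0` if the centres coincide, and
otherwise `exp(d / 2)`, where `d` is the complex distance from the inward spin frame of `H₁` to
the outward spin frame of `H₂` at the points where the oriented geodesic from the centre of `H₁`
to the centre of `H₂` meets the two horospheres. -/
def IsLambdaLength (H₁ H₂ : SpinDecoratedHorosphere) (l : ℂ) : Prop :=
  (H₁.centre = H₂.centre ∧ l = 0) ∨
  (H₁.centre ≠ H₂.centre ∧ ∃ A : SL2C,
    actBoundary A ((0 : ℂ) : OnePoint ℂ) = H₁.centre ∧ actBoundary A OnePoint.infty = H₂.centre ∧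
    ∃ (q₁ : H₁.carrier) (q₂ : H₂.carrier), (q₁ : Space) ∈ Set.range (geod A) ∧
      (q₂ : Space) ∈ Set.range (geod A) ∧
      ∃ d : ℂ, IsComplexDistance A (H₁.Win q₁) (H₂.Wout q₂) d ∧ l = Complex.exp (d / 2))

end

end SpinHoro

/-!
Spin frames are elements of `SL(2, ℂ)`. The unit outward frames of the decorated horosphere of `κ`
are exactly the matrices `W` with first column `κ`, up to a sign; since `SL(2, ℂ)` is connected, a
continuous lift chooses the same sign for all `κ` and all points of the horosphere. The matching
inward frame is `W * J`, where `J` is the half-turn about the second vector of the frame.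

Frames adapted to one oriented geodesic differ by a diagonal matrix on the right, and those at
complex distance `d` by `diag(e^{d/2}, e^{-d/2})`. Hence `W₁⁻¹ W₂ = J diag(e^{d/2}, e^{-d/2})` along
the geodesic from the centre of `κ₁` to that of `κ₂`. The lower left entry of the right-hand side is
`e^{d/2}`, and that of `W₁⁻¹ W₂` is `{κ₁, κ₂}`.
-/

namespace SpinHoro

noncomputable section

open Matrix.SpecialLinearGroup (coe_mul coe_one coe_neg det_coe)
open scoped ComplexOrder

/-! ### The action on Minkowski space -/

theorem gInv_injective : Function.Injective gInv := fun v w h => by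
  rw [← g_gInv v, ← g_gInv w]; congr 2

theorem gInv_add (v w : Mink) : gInv (v + w) = gInv v + gInv w := by
  ext i j; fin_cases i <;> fin_cases j <;> simp [gInv] <;> ring

theorem gInv_smul (c : ℝ) (v : Mink) : gInv (c • v) = (c : ℂ) • gInv v := by
  ext i j; fin_cases i <;> fin_cases j <;> simp [gInv] <;> ring

theorem gInv_actM (A : SL2C) (v : Mink) : gInv (actM A v) = A.1 * gInv v * A.1ᴴ := by
  rw [actM, gInv_g]

theorem actM_mul (A B : SL2C) (v : Mink) : actM (A * B) v = actM A (actM B v) :=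
  gInv_injective (by
    simp only [gInv_actM, coe_mul, conjTranspose_mul, Matrix.mul_assoc])

theorem actM_one (v : Mink) : actM 1 v = v := gInv_injective (by simp [gInv_actM])

theorem actM_actM_inv (A : SL2C) (v : Mink) : actM A (actM A⁻¹ v) = v := by
  rw [← actM_mul, mul_inv_cancel, actM_one]

theorem actM_inv_actM (A : SL2C) (v : Mink) : actM A⁻¹ (actM A v) = v := by
  rw [← actM_mul, inv_mul_cancel, actM_one]

/-- The action of `A` on Minkowski space as a continuous linear map. -/
def actMLin (A : SL2C) : Mink →L[ℝ] Mink :=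
  LinearMap.toContinuousLinearMap
    { toFun := actM A
      map_add' := fun v w => gInv_injective (by
        simp only [gInv_actM, gInv_add, Matrix.mul_add, Matrix.add_mul])
      map_smul' := fun c v => gInv_injective (by
        simp only [gInv_actM, gInv_smul, Matrix.mul_smul, Matrix.smul_mul, RingHom.id_apply]) }

theorem actM_add (A : SL2C) (v w : Mink) : actM A (v + w) = actM A v + actM A w :=
  map_add (actMLin A) v w

theorem actM_smul (A : SL2C) (c : ℝ) (v : Mink) : actM A (c • v) = c • actM A v :=
  map_smul (actMLin A) c v

theorem mform_self (v : Mink) : (mform v v : ℂ) = 4 * (gInv v).det := by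
  simp only [mform, gInv, det_fin_two_of]
  push_cast
  linear_combination (-(v 2 : ℂ) ^ 2) * Complex.I_sq

theorem mform_actM_self (A : SL2C) (v : Mink) : mform (actM A v) (actM A v) = mform v v := by
  rw [← Complex.ofReal_inj, mform_self, mform_self, gInv_actM, det_mul, det_mul,
    det_conjTranspose, A.2]
  simp

theorem mform_polar (v w : Mink) :
    2 * mform v w = mform (v + w) (v + w) - mform v v - mform w w := by
  simp only [mform, Pi.add_apply]; ring

theorem mform_actM (A : SL2C) (v w : Mink) : mform (actM A v) (actM A w) = mform v w := by
  have h := mform_polar (actM A v) (actM A w)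
  rw [← actM_add, mform_actM_self, mform_actM_self, mform_actM_self, ← mform_polar] at h
  linarith

/-! ### Triangular subgroups -/

/-- The diagonal matrices `diag(u, u⁻¹)`. -/
def torus : ℂˣ →* SL2C where
  toFun u := ⟨!![(u : ℂ), 0; 0, (u : ℂ)⁻¹], by simp [det_fin_two_of]⟩
  map_one' := by ext i j; fin_cases i <;> fin_cases j <;> simp
  map_mul' u v := Subtype.ext (by
    change _ = !![(u : ℂ), 0; 0, (u : ℂ)⁻¹] * !![(v : ℂ), 0; 0, (v : ℂ)⁻¹]
    simp [mul_comm])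

/-- The upper unipotent matrix with off-diagonal entry `w`. -/
def unipotent (w : ℂ) : SL2C := ⟨!![1, w; 0, 1], by simp [det_fin_two_of]⟩

theorem coe_torus (u : ℂˣ) : (torus u).1 = !![(u : ℂ), 0; 0, (u : ℂ)⁻¹] := rfl

theorem coe_unipotent (w : ℂ) : (unipotent w).1 = !![1, w; 0, 1] := rfl

/-! ### The hyperboloid and the upper half space -/

/-- The point `(1, 0, 0, 0)` of the hyperboloid. -/
def hypBase : Mink := ![1, 0, 0, 0]

/-- The isometry from the hyperboloid to the upper half space. -/
def toUpper (v : Mink) : Space := jMap (iMap v)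

/-- The inverse of `toUpper`. -/
def toHyperboloid (x : Space) : Mink := iInv (jInv x)

theorem gInv_hypBase : gInv hypBase = (1 / 2 : ℂ) • (1 : Matrix (Fin 2) (Fin 2) ℂ) := by
  ext i j; fin_cases i <;> fin_cases j <;> simp [gInv, hypBase]

theorem gInv_actM_hypBase (A : SL2C) : gInv (actM A hypBase) = (1 / 2 : ℂ) • (A.1 * A.1ᴴ) := by
  rw [gInv_actM, gInv_hypBase, Matrix.mul_smul, Matrix.mul_one, Matrix.smul_mul]

theorem hypBase_mem : hypBase ∈ hyperboloid := by simp [hyperboloid, hypBase, mform]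

theorem sub_pos_of_mem_hyperboloid {v : Mink} (hv : v ∈ hyperboloid) : 0 < v 0 - v 3 := by
  obtain ⟨h1, h2⟩ := hv
  simp only [mform] at h1
  nlinarith [sq_nonneg (v 1), sq_nonneg (v 2)]

theorem iMap_dotProduct_self {v : Mink} (hv : v ∈ hyperboloid) :
    iMap v ⬝ᵥ iMap v = 1 - 2 / (1 + v 0) := by
  have h1 : v 0 * v 0 - v 1 * v 1 - v 2 * v 2 - v 3 * v 3 = 1 := hv.1
  have h0 : 1 + v 0 ≠ 0 := by linarith [hv.2]
  simp only [iMap, dotProduct, Fin.sum_univ_three, cons_val_zero, cons_val_one, cons_val]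
  field_simp
  linear_combination -h1

theorem toUpper_apply {v : Mink} (hv : v ∈ hyperboloid) :
    toUpper v = (v 0 - v 3)⁻¹ • ![v 1, v 2, 1] := by
  have h1 : v 0 * v 0 - v 1 * v 1 - v 2 * v 2 - v 3 * v 3 = 1 := hv.1
  have h0 : 1 + v 0 ≠ 0 := by linarith [hv.2]
  have hn := (sub_pos_of_mem_hyperboloid hv).ne'
  have hD : iMap v 0 ^ 2 + iMap v 1 ^ 2 + (1 - iMap v 2) ^ 2 =
      2 * (v 0 - v 3) / (1 + v 0) := by
    simp only [iMap, cons_val_zero, cons_val_one, cons_val]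
    field_simp
    linear_combination -h1
  simp only [toUpper, jMap, hD, iMap_dotProduct_self hv]
  ext k
  fin_cases k <;> simp [iMap] <;> field_simp

theorem toHyperboloid_apply {x : Space} (hx : 0 < x 2) :
    toHyperboloid x = (2 * x 2)⁻¹ •
      ![x ⬝ᵥ x + 1, 2 * x 0, 2 * x 1, x ⬝ᵥ x - 1] := by
  obtain ⟨D, hD⟩ : ∃ D, D = x 0 ^ 2 + x 1 ^ 2 + (x 2 + 1) ^ 2 := ⟨_, rfl⟩
  have hD0 : D ≠ 0 := by rw [hD]; positivity
  have hx' : x ⬝ᵥ x = D - 2 * x 2 - 1 := by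
    rw [hD]; simp only [dotProduct, Fin.sum_univ_three]; ring
  have hS : jInv x ⬝ᵥ jInv x = 1 - 4 * x 2 / D := by
    simp only [jInv, ← hD, dotProduct, Fin.sum_univ_three, cons_val_zero, cons_val_one,
      cons_val]
    field_simp
    rw [hD]
    ring
  simp only [toHyperboloid, iInv, hS, sub_sub_cancel]
  ext k
  fin_cases k <;> simp [jInv, ← hD, hx'] <;> field_simp <;> ring

theorem toHyperboloid_mem {x : Space} (hx : 0 < x 2) : toHyperboloid x ∈ hyperboloid := by
  rw [toHyperboloid_apply hx]
  constructor
  · simp [mform, dotProduct, Fin.sum_univ_three]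
    field_simp
    ring
  · have : 0 ≤ x ⬝ᵥ x := dotProduct_self_star_nonneg x
    simp only [Pi.smul_apply, cons_val_zero, smul_eq_mul]
    positivity

theorem toUpper_toHyperboloid {x : Space} (hx : 0 < x 2) : toUpper (toHyperboloid x) = x := by
  rw [toUpper_apply (toHyperboloid_mem hx), toHyperboloid_apply hx]
  ext k
  fin_cases k <;> simp <;> field_simp <;> ring

theorem iMap_dotProduct_self_lt_one {v : Mink} (hv : v ∈ hyperboloid) :
    iMap v ⬝ᵥ iMap v < 1 := by
  have := hv.2
  rw [iMap_dotProduct_self hv]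
  exact sub_lt_self _ (by positivity)

theorem toHyperboloid_toUpper {v : Mink} (hv : v ∈ hyperboloid) :
    toHyperboloid (toUpper v) = v := by
  rw [toHyperboloid, toUpper, jInv_jMap _ (iMap_dotProduct_self_lt_one hv), iInv_iMap _ hv]

theorem toUpper_pos {v : Mink} (hv : v ∈ hyperboloid) : 0 < toUpper v 2 := by
  rw [toUpper_apply hv]; simpa using sub_pos_of_mem_hyperboloid hv

theorem toUpper_injOn : Set.InjOn toUpper hyperboloid := fun v hv w hw h => by
  rw [← toHyperboloid_toUpper hv, h, toHyperboloid_toUpper hw]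

theorem conjTranspose_fin_two_of {α : Type*} [Star α] (a b c d : α) :
    !![a, b; c, d]ᴴ = !![star a, star c; star b, star d] := by
  ext i j; fin_cases i <;> fin_cases j <;> rfl

/-- The point of the upper half space over `z ∈ ℂ` at height `t`. -/
def upperPt (z : ℂ) (t : ℝ) : Space := ![z.re, z.im, t]

theorem eq_upperPt (x : Space) : x = upperPt ⟨x 0, x 1⟩ (x 2) := by
  ext k; fin_cases k <;> rfl

theorem gInv_toHyperboloid_upperPt (z : ℂ) {t : ℝ} (ht : 0 < t) :
    gInv (toHyperboloid (upperPt z t)) =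
      ((2 * t : ℝ) : ℂ)⁻¹ • !![z * star z + t ^ 2, z; star z, 1] := by
  rw [toHyperboloid_apply ht, gInv_smul, Complex.ofReal_inv]
  congr 1
  ext i j
  fin_cases i <;> fin_cases j <;> apply Complex.ext <;>
    simp [gInv, upperPt, dotProduct, Fin.sum_univ_three, sq] <;> ring

/-- The unit of `ℂ` given by a positive real number. -/
def realUnit (r : ℝ) (hr : 0 < r) : ℂˣ := Units.mk0 (r : ℂ) (Complex.ofReal_ne_zero.2 hr.ne')

/-- The upper triangular matrix carrying the base point `(0, 0, 1)` to `upperPt z t`. -/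
def triangular (z : ℂ) (t : ℝ) (ht : 0 < t) : SL2C :=
  unipotent z * torus (realUnit √t (Real.sqrt_pos.2 ht))

theorem actM_triangular_hypBase (z : ℂ) {t : ℝ} (ht : 0 < t) :
    actM (triangular z t ht) hypBase = toHyperboloid (upperPt z t) := by
  have hr : (√t : ℂ) ≠ 0 := Complex.ofReal_ne_zero.2 (Real.sqrt_pos.2 ht).ne'
  have hrr : (t : ℂ) = √t * √t := by exact_mod_cast (Real.mul_self_sqrt ht.le).symm
  refine gInv_injective ?_
  rw [gInv_actM_hypBase, gInv_toHyperboloid_upperPt z ht, triangular, coe_mul, coe_unipotent,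
    coe_torus]
  ext i j
  fin_cases i <;> fin_cases j <;>
    simp [realUnit, conjTranspose_fin_two_of, hrr] <;> field_simp
  ring

theorem actM_hypBase_mem (A : SL2C) : actM A hypBase ∈ hyperboloid := by
  refine ⟨by rw [mform_actM]; exact hypBase_mem.1, ?_⟩
  have hT (v : Mink) : (v 0 : ℂ) = (gInv v).trace := by simp [gInv, trace_fin_two]; ring
  have h : actM A hypBase 0 = (A.1 * A.1ᴴ).trace.re / 2 := by
    rw [← Complex.ofReal_re (actM A hypBase 0), hT, gInv_actM_hypBase, trace_smul]
    simp; ring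
  have hA : A.1 ≠ 0 := fun h0 => by simpa [h0] using A.det_coe
  have hpos := (posSemidef_self_mul_conjTranspose A.1).trace_nonneg
  have hne : (A.1 * A.1ᴴ).trace ≠ 0 := trace_mul_conjTranspose_self_eq_zero_iff.not.2 hA
  rw [h]
  exact half_pos (Complex.pos_iff.1 (lt_of_le_of_ne hpos hne.symm)).1

theorem actM_mem {A : SL2C} {v : Mink} (hv : v ∈ hyperboloid) : actM A v ∈ hyperboloid := by
  rw [← toHyperboloid_toUpper hv, eq_upperPt (toUpper v),
    ← actM_triangular_hypBase _ (toUpper_pos hv), ← actM_mul]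
  exact actM_hypBase_mem _

/-! ### The action on the upper half space -/

theorem act_eq (A : SL2C) (x : Space) : act A x = toUpper (actM A (toHyperboloid x)) := rfl

theorem toHyperboloid_act (A : SL2C) {x : Space} (hx : 0 < x 2) :
    toHyperboloid (act A x) = actM A (toHyperboloid x) :=
  toHyperboloid_toUpper (actM_mem (toHyperboloid_mem hx))

theorem act_pos (A : SL2C) {x : Space} (hx : 0 < x 2) : 0 < act A x 2 :=
  toUpper_pos (actM_mem (toHyperboloid_mem hx))

theorem act_mul (A B : SL2C) {x : Space} (hx : 0 < x 2) : act (A * B) x = act A (act B x) := by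
  rw [act_eq, act_eq A, toHyperboloid_act B hx, actM_mul]

theorem act_one {x : Space} (hx : 0 < x 2) : act 1 x = x := by
  rw [act_eq, actM_one, toUpper_toHyperboloid hx]

theorem act_neg (A : SL2C) : act (-A) = act A := by
  have (v : Mink) : actM (-A) v = actM A v := gInv_injective (by simp [gInv_actM])
  funext x
  rw [act_eq, this, act_eq]

theorem act_eq_of_gInv {A : SL2C} {x y : Space} (hy : 0 < y 2)
    (h : A.1 * gInv (toHyperboloid x) * A.1ᴴ = gInv (toHyperboloid y)) : act A x = y := by
  rw [← toUpper_toHyperboloid hy, act_eq]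
  exact congrArg toUpper (gInv_injective (by rw [gInv_actM, h]))

theorem act_unipotent (w z : ℂ) {t : ℝ} (ht : 0 < t) :
    act (unipotent w) (upperPt z t) = upperPt (z + w) t := by
  refine act_eq_of_gInv ht ?_
  rw [gInv_toHyperboloid_upperPt _ ht, gInv_toHyperboloid_upperPt _ ht, coe_unipotent,
    conjTranspose_fin_two_of]
  ext i j
  fin_cases i <;> fin_cases j <;> simp <;> ring

theorem act_torus (u : ℂˣ) (z : ℂ) {t : ℝ} (ht : 0 < t) :
    act (torus u) (upperPt z t) = upperPt (u ^ 2 * z) (Complex.normSq u * t) := by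
  have hut : 0 < Complex.normSq u * t := mul_pos (Complex.normSq_pos.2 u.ne_zero) ht
  have hu : star (u : ℂ) ≠ 0 := star_ne_zero.2 u.ne_zero
  have ht' : (t : ℂ) ≠ 0 := Complex.ofReal_ne_zero.2 ht.ne'
  refine act_eq_of_gInv hut ?_
  rw [gInv_toHyperboloid_upperPt _ ht, gInv_toHyperboloid_upperPt _ hut, coe_torus,
    conjTranspose_fin_two_of]
  ext i j
  fin_cases i <;> fin_cases j <;>
    simp [Complex.normSq_eq_conj_mul_self] at hu ⊢ <;> field_simp

theorem basePt_pos : 0 < basePt 2 := by simp [basePt]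

theorem toUpper_hypBase : toUpper hypBase = basePt := by
  rw [toUpper_apply hypBase_mem]; ext k; fin_cases k <;> simp [hypBase, basePt]

theorem toHyperboloid_basePt : toHyperboloid basePt = hypBase := by
  rw [← toUpper_hypBase, toHyperboloid_toUpper hypBase_mem]

theorem act_basePt (A : SL2C) : act A basePt = toUpper (actM A hypBase) := by
  rw [act_eq, toHyperboloid_basePt]

theorem act_basePt_pos (A : SL2C) : 0 < act A basePt 2 := act_pos A basePt_pos

theorem act_triangular_basePt (z : ℂ) {t : ℝ} (ht : 0 < t) :
    act (triangular z t ht) basePt = upperPt z t := by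
  rw [act_basePt, actM_triangular_hypBase, toUpper_toHyperboloid ht]

theorem act_basePt_eq_iff {A B : SL2C} :
    act A basePt = act B basePt ↔ A.1 * A.1ᴴ = B.1 * B.1ᴴ := by
  rw [act_basePt, act_basePt, toUpper_injOn.eq_iff (actM_hypBase_mem A) (actM_hypBase_mem B),
    ← gInv_injective.eq_iff, gInv_actM_hypBase, gInv_actM_hypBase]
  exact (IsUnit.mk0 (1 / 2 : ℂ) (by norm_num)).smul_left_cancel

/-! ### Derivatives of the isometries -/

theorem differentiableAt_iMap {v : Mink} (hv : v ∈ hyperboloid) : DifferentiableAt ℝ iMap v := by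
  have h0 : 1 + v 0 ≠ 0 := by linarith [hv.2]
  unfold iMap
  rw [differentiableAt_pi]
  intro i
  fin_cases i <;> simp only [Fin.zero_eta, Fin.mk_one, Fin.reduceFinMk, cons_val] <;>
    fun_prop (disch := exact h0)

theorem differentiableAt_jMap {x : Space} (hx : x ⬝ᵥ x < 1) : DifferentiableAt ℝ jMap x := by
  simp only [dotProduct, Fin.sum_univ_three] at hx
  have h2 : 0 < 1 - x 2 := by nlinarith [sq_nonneg (x 0), sq_nonneg (x 1)]
  have hD : x 0 ^ 2 + x 1 ^ 2 + (1 - x 2) ^ 2 ≠ 0 := by positivity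
  unfold jMap dotProduct
  rw [differentiableAt_pi]
  intro i
  fin_cases i <;> simp only [Fin.zero_eta, Fin.mk_one, Fin.reduceFinMk, cons_val] <;>
    fun_prop (disch := exact hD)

theorem hasFDerivAt_toUpper {v : Mink} (hv : v ∈ hyperboloid) :
    HasFDerivAt toUpper ((fderiv ℝ jMap (iMap v)).comp (fderiv ℝ iMap v)) v :=
  (differentiableAt_jMap (iMap_dotProduct_self_lt_one hv)).hasFDerivAt.comp v
    (differentiableAt_iMap hv).hasFDerivAt

theorem eventually_pos {x : Space} (hx : 0 < x 2) : ∀ᶠ y : Space in nhds x, 0 < y 2 :=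
  (isOpen_lt continuous_const (continuous_apply (2 : Fin 3))).mem_nhds hx

theorem toHyperboloid_eventuallyEq {x : Space} (hx : 0 < x 2) :
    toHyperboloid =ᶠ[nhds x] fun y => (2 * y 2)⁻¹ •
      ![y ⬝ᵥ y + 1, 2 * y 0, 2 * y 1, y ⬝ᵥ y - 1] := by
  filter_upwards [eventually_pos hx] with y hy using toHyperboloid_apply hy

theorem differentiableAt_toHyperboloid {x : Space} (hx : 0 < x 2) :
    DifferentiableAt ℝ toHyperboloid x := by
  have hne : 2 * x 2 ≠ 0 := by positivity
  refine DifferentiableAt.congr_of_eventuallyEq ?_ (toHyperboloid_eventuallyEq hx)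
  refine DifferentiableAt.fun_smul (by fun_prop (disch := exact hne)) ?_
  unfold dotProduct
  rw [differentiableAt_pi]
  intro i
  fin_cases i <;> simp only [Fin.zero_eta, Fin.mk_one, Fin.reduceFinMk, cons_val] <;>
    fun_prop

/-- The tangent vector of the hyperboloid at `(1, 0, 0, 0)` that corresponds to the tangent
vector `u` of the upper half space at `(0, 0, 1)`. -/
def tangentBase (u : Space) : Mink := ![0, u 0, u 1, u 2]

theorem fderiv_toHyperboloid_basePt (u : Space) :
    fderiv ℝ toHyperboloid basePt u = tangentBase u := by
  have hline : HasDerivAt (fun t : ℝ => basePt + t • u) u 0 := by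
    simpa using ((hasDerivAt_id (0 : ℝ)).smul_const u).const_add basePt
  have hcoord (i : Fin 3) := hasDerivAt_pi.1 hline i
  have hdot : HasDerivAt (fun t : ℝ => (basePt + t • u) ⬝ᵥ (basePt + t • u)) (2 * u 2) 0 := by
    refine (HasDerivAt.fun_sum fun i _ => (hcoord i).mul (hcoord i)).congr_deriv ?_
    simp [Fin.sum_univ_three, basePt]
    ring
  have hvec : HasDerivAt (fun t : ℝ => ![(basePt + t • u) ⬝ᵥ (basePt + t • u) + 1,
      2 * (basePt + t • u) 0, 2 * (basePt + t • u) 1,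
      (basePt + t • u) ⬝ᵥ (basePt + t • u) - 1]) ![2 * u 2, 2 * u 0, 2 * u 1, 2 * u 2] 0 := by
    refine hasDerivAt_pi.2 fun i => ?_
    fin_cases i
    exacts [hdot.add_const 1, (hcoord 0).const_mul 2, (hcoord 1).const_mul 2, hdot.sub_const 1]
  have hinv := ((hcoord 2).const_mul 2).fun_inv (by simp [basePt])
  have h0 : basePt + (0 : ℝ) • u = basePt := by simp
  have heq := toHyperboloid_eventuallyEq basePt_pos
  rw [← h0] at heq
  have hderiv := (hinv.fun_smul hvec).congr_of_eventuallyEq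
    (hline.continuousAt.eventually heq)
  have hfderiv := (differentiableAt_toHyperboloid basePt_pos).hasFDerivAt.hasLineDerivAt u
  rw [HasLineDerivAt] at hfderiv
  rw [hfderiv.unique hderiv]
  ext i
  fin_cases i <;> simp [basePt, tangentBase, dotProduct, Fin.sum_univ_three]
  ring

theorem hasFDerivAt_act (A : SL2C) {x : Space} (hx : 0 < x 2) :
    HasFDerivAt (act A) (((fderiv ℝ toUpper (actM A (toHyperboloid x))).comp (actMLin A)).comp
      (fderiv ℝ toHyperboloid x)) x := by
  have hU : HasFDerivAt toUpper _ (actMLin A (toHyperboloid x)) :=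
    (hasFDerivAt_toUpper (actM_mem (toHyperboloid_mem hx))).differentiableAt.hasFDerivAt
  exact (hU.comp _ (actMLin A).hasFDerivAt).comp x (differentiableAt_toHyperboloid hx).hasFDerivAt

theorem hasFDerivAt_dact (A : SL2C) {x : Space} (hx : 0 < x 2) :
    HasFDerivAt (act A) (dact A x) x := (hasFDerivAt_act A hx).differentiableAt.hasFDerivAt

theorem dact_mul (A B : SL2C) {x : Space} (hx : 0 < x 2) (u : Space) :
    dact (A * B) x u = dact A (act B x) (dact B x u) := by
  have heq : act (A * B) =ᶠ[nhds x] act A ∘ act B := by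
    filter_upwards [eventually_pos hx] with y hy using act_mul A B hy
  have h := (hasFDerivAt_dact A (act_pos B hx)).comp x (hasFDerivAt_dact B hx)
  rw [dact, (h.congr_of_eventuallyEq heq).fderiv, ContinuousLinearMap.comp_apply]

theorem dact_eq_of_hasFDerivAt {A : SL2C} {x : Space} {φ : Space → Space}
    {φ' : Space →L[ℝ] Space} (hφ' : HasFDerivAt φ φ' x)
    (hφ : ∀ y : Space, 0 < y 2 → act A y = φ y) (hx : 0 < x 2) : dact A x = φ' := by
  have heq : act A =ᶠ[nhds x] φ := by
    filter_upwards [eventually_pos hx] with y hy using hφ y hy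
  exact (hφ'.congr_of_eventuallyEq heq).fderiv

theorem dact_one {x : Space} (hx : 0 < x 2) (u : Space) : dact 1 x u = u := by
  rw [dact_eq_of_hasFDerivAt (hasFDerivAt_id x) (fun y hy => act_one hy) hx]; rfl

theorem dact_neg (A : SL2C) (x : Space) : dact (-A) x = dact A x := by rw [dact, dact, act_neg]

theorem dact_basePt (A : SL2C) (u : Space) :
    dact A basePt u = fderiv ℝ toUpper (actM A hypBase) (actM A (tangentBase u)) := by
  rw [dact, (hasFDerivAt_act A basePt_pos).fderiv, toHyperboloid_basePt]
  simp only [ContinuousLinearMap.comp_apply, fderiv_toHyperboloid_basePt]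
  rfl

theorem dact_unipotent (w : ℂ) {x : Space} (hx : 0 < x 2) (u : Space) :
    dact (unipotent w) x u = u := by
  rw [dact_eq_of_hasFDerivAt ((hasFDerivAt_id x).add_const ![w.re, w.im, 0]) (fun y hy => ?_) hx]
  · rfl
  · rw [eq_upperPt y, act_unipotent _ _ hy]
    ext k; fin_cases k <;> simp [upperPt]

theorem dact_torus_realUnit {r : ℝ} (hr : 0 < r) {x : Space} (hx : 0 < x 2) (u : Space) :
    dact (torus (realUnit r hr)) x u = r ^ 2 • u := by
  rw [dact_eq_of_hasFDerivAt ((hasFDerivAt_id x).const_smul (r ^ 2)) (fun y hy => ?_) hx]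
  · rfl
  · rw [eq_upperPt y, act_torus _ _ hy]
    ext k; fin_cases k <;> simp [upperPt, realUnit, sq]

/-! ### The rotation group at the base point -/

/-- The traceless Hermitian matrix of a vector: the isomorphism through which the unitary matrices
of `SL(2, ℂ)` rotate the tangent space at `(0, 0, 1)`. The middle basis vector corresponds to minus
the usual Pauli matrix, in accordance with the convention for `g`. -/
def pauli (u : Space) : Matrix (Fin 2) (Fin 2) ℂ :=
  !![(u 2 : ℂ), u 0 + u 1 * Complex.I; u 0 - u 1 * Complex.I, -u 2]

theorem gInv_tangentBase (u : Space) : gInv (tangentBase u) = (1 / 2 : ℂ) • pauli u := by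
  ext i j
  fin_cases i <;> fin_cases j <;> simp [gInv, tangentBase, pauli] <;> ring

theorem pauli_injective : Function.Injective pauli := fun u v h => by
  have h' : gInv (tangentBase u) = gInv (tangentBase v) := by
    rw [gInv_tangentBase, gInv_tangentBase, h]
  have := gInv_injective h'
  ext i
  fin_cases i
  exacts [congrFun this 1, congrFun this 2, congrFun this 3]

theorem pauli_mul_pauli (u v : Space) :
    pauli u * pauli v = ((u ⬝ᵥ v : ℝ) : ℂ) • 1 - Complex.I • pauli (u ⨯₃ v) := by
  ext i j
  fin_cases i <;> fin_cases j <;> apply Complex.ext <;>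
    simp [pauli, dotProduct, Fin.sum_univ_three, cross_apply] <;> ring

theorem trace_pauli_mul_pauli (u v : Space) :
    (pauli u * pauli v).trace = ((2 * (u ⬝ᵥ v) : ℝ) : ℂ) := by
  have hpauli : (pauli (u ⨯₃ v)).trace = 0 := by simp [pauli, trace_fin_two]
  rw [pauli_mul_pauli, trace_sub, trace_smul, trace_smul, hpauli, trace_one]
  simp [mul_comm]

theorem act_basePt_eq_self_iff {k : SL2C} : act k basePt = basePt ↔ k.1 * k.1ᴴ = 1 := by
  rw [← act_one basePt_pos (x := basePt), ← act_mul _ _ basePt_pos, mul_one, act_basePt_eq_iff]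
  simp

theorem mform_hypBase_eq_zero_iff {v : Mink} :
    mform hypBase v = 0 ↔ ∃ u : Space, v = tangentBase u := by
  simp only [mform, hypBase, tangentBase]
  constructor
  · intro h
    refine ⟨![v 1, v 2, v 3], ?_⟩
    ext i
    fin_cases i <;> simp_all
  · rintro ⟨u, rfl⟩
    simp

theorem pauli_dact_basePt {k : SL2C} (hk : k.1 * k.1ᴴ = 1) (u : Space) :
    pauli (dact k basePt u) = k.1 * pauli u * k.1ᴴ := by
  have hbase : actM k hypBase = hypBase :=
    gInv_injective (by rw [gInv_actM_hypBase, hk, gInv_hypBase])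
  obtain ⟨w, hw⟩ := mform_hypBase_eq_zero_iff.1 (show mform hypBase (actM k (tangentBase u)) = 0 by
    rw [← hbase, mform_actM]; exact mform_hypBase_eq_zero_iff.2 ⟨u, rfl⟩)
  have hdact : dact k basePt u = w := by
    have hone := dact_one basePt_pos w
    rw [dact_basePt, actM_one, actM_one] at hone
    rw [dact_basePt, hw, hbase, hone]
  have h := congrArg gInv hw
  rw [gInv_actM, gInv_tangentBase, gInv_tangentBase, Matrix.mul_smul, Matrix.smul_mul] at h
  rw [hdact, (IsUnit.mk0 (1 / 2 : ℂ) (by norm_num)).smul_left_cancel.1 h]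

theorem pauli_dact_basePt_mul {k : SL2C} (hk : k.1 * k.1ᴴ = 1) (u : Space) :
    pauli (dact k basePt u) * k.1 = k.1 * pauli u := by
  rw [pauli_dact_basePt hk, Matrix.mul_assoc, mul_eq_one_comm.1 hk, Matrix.mul_one]

theorem pauli_dact_basePt_mul_pauli {k : SL2C} (hk : k.1 * k.1ᴴ = 1) (u v : Space) :
    pauli (dact k basePt u) * pauli (dact k basePt v) = k.1 * (pauli u * pauli v) * k.1ᴴ := by
  rw [pauli_dact_basePt hk v, ← Matrix.mul_assoc, ← Matrix.mul_assoc, pauli_dact_basePt_mul hk,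
    Matrix.mul_assoc k.1]

theorem dotProduct_dact_of_unitary {k : SL2C} (hk : k.1 * k.1ᴴ = 1) (u v : Space) :
    dact k basePt u ⬝ᵥ dact k basePt v = u ⬝ᵥ v := by
  have h := trace_pauli_mul_pauli (dact k basePt u) (dact k basePt v)
  rw [pauli_dact_basePt_mul_pauli hk, trace_mul_comm, ← Matrix.mul_assoc, mul_eq_one_comm.1 hk,
    Matrix.one_mul, trace_pauli_mul_pauli, Complex.ofReal_inj] at h
  linarith

theorem cross_dact_of_unitary {k : SL2C} (hk : k.1 * k.1ᴴ = 1) (u v : Space) :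
    dact k basePt u ⨯₃ dact k basePt v = dact k basePt (u ⨯₃ v) := by
  have h := pauli_dact_basePt_mul_pauli hk u v
  rw [pauli_mul_pauli, pauli_mul_pauli, dotProduct_dact_of_unitary hk, Matrix.mul_sub,
    Matrix.sub_mul, Matrix.mul_smul, Matrix.mul_smul, Matrix.smul_mul, Matrix.smul_mul,
    Matrix.mul_one, hk, sub_right_inj, ← pauli_dact_basePt hk] at h
  exact pauli_injective (smul_right_injective _ Complex.I_ne_zero h)

/-! ### Frames -/

/-- The Iwasawa decomposition, read on tangent vectors. -/
theorem exists_unitary_dact_basePt (A : SL2C) : ∃ k : SL2C, k.1 * k.1ᴴ = 1 ∧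
    ∀ u, dact A basePt u = act A basePt 2 • dact k basePt u := by
  obtain ⟨z, t, ht, hA⟩ : ∃ (z : ℂ) (t : ℝ), 0 < t ∧ act A basePt = upperPt z t :=
    ⟨_, _, act_basePt_pos A, eq_upperPt _⟩
  have hk : act ((triangular z t ht)⁻¹ * A) basePt = basePt := by
    rw [act_mul _ _ basePt_pos, hA, ← act_triangular_basePt z ht, ← act_mul _ _ basePt_pos,
      inv_mul_cancel, act_one basePt_pos]
  refine ⟨(triangular z t ht)⁻¹ * A, act_basePt_eq_self_iff.1 hk, fun u => ?_⟩
  rw [← mul_inv_cancel_left (triangular z t ht) A, dact_mul _ _ basePt_pos, hk, triangular,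
    dact_mul _ _ basePt_pos, dact_unipotent _ (act_basePt_pos _),
    dact_torus_realUnit _ basePt_pos, Real.sq_sqrt ht.le, mul_inv_cancel_left, hA]
  rfl

theorem dotProduct_dact_basePt (A : SL2C) (u v : Space) :
    dact A basePt u ⬝ᵥ dact A basePt v = act A basePt 2 ^ 2 * (u ⬝ᵥ v) := by
  obtain ⟨k, hk, hA⟩ := exists_unitary_dact_basePt A
  rw [hA, hA, dotProduct_smul, smul_dotProduct, dotProduct_dact_of_unitary hk, smul_smul, sq]
  rfl

theorem isUnitAt_dact_basePt (A : SL2C) {u : Space} :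
    IsUnitAt (act A basePt) (dact A basePt u) ↔ u ⬝ᵥ u = 1 := by
  rw [IsUnitAt, dotProduct_dact_basePt, mul_eq_left₀ (pow_pos (act_basePt_pos A) 2).ne']

theorem hcross_dact_basePt (A : SL2C) (u v : Space) :
    hcross (act A basePt) (dact A basePt u) (dact A basePt v) = dact A basePt (u ⨯₃ v) := by
  obtain ⟨k, hk, hA⟩ := exists_unitary_dact_basePt A
  rw [hcross, hA, hA, hA, map_smul, LinearMap.map_smul₂, cross_dact_of_unitary hk,
    inv_smul_smul₀ (act_basePt_pos A).ne']

theorem frameOf_eq (A : SL2C) : frameOf A = ⟨act A basePt, dact A basePt ![0, 0, 1],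
    dact A basePt ![0, 1, 0],
    hcross (act A basePt) (dact A basePt ![0, 0, 1]) (dact A basePt ![0, 1, 0])⟩ := by
  rw [hcross_dact_basePt, frameOf]
  simp [cross_apply]

theorem dact_inv_mul_eq {A B : SL2C} (hpt : act A basePt = act B basePt) {u v : Space}
    (h : dact A basePt u = dact B basePt v) : dact (B⁻¹ * A) basePt u = v := by
  rw [dact_mul _ _ basePt_pos, h, hpt, ← dact_mul _ _ basePt_pos, inv_mul_cancel,
    dact_one basePt_pos]

theorem act_inv_mul_eq {A B : SL2C} (hpt : act A basePt = act B basePt) :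
    act (B⁻¹ * A) basePt = basePt := by
  rw [act_mul _ _ basePt_pos, hpt, ← act_mul _ _ basePt_pos, inv_mul_cancel, act_one basePt_pos]

theorem eq_torus_of_offDiag_eq_zero {k : SL2C} (h01 : k.1 0 1 = 0) (h10 : k.1 1 0 = 0) :
    ∃ u : ℂˣ, k = torus u := by
  have hdet : k.1 0 0 * k.1 1 1 = 1 := by
    have h := k.2
    rwa [det_fin_two, h01, zero_mul, sub_zero] at h
  refine ⟨Units.mkOfMulEqOne _ _ hdet, ?_⟩
  ext i j
  fin_cases i <;> fin_cases j
  exacts [rfl, h01, h10, eq_inv_of_mul_eq_one_right hdet]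

theorem exists_eq_mul_torus_of_dact_eq {A B : SL2C} (hpt : act A basePt = act B basePt)
    (h : dact A basePt ![0, 0, 1] = dact B basePt ![0, 0, 1]) :
    ∃ u : ℂˣ, Complex.normSq u = 1 ∧ A = B * torus u := by
  obtain ⟨k, rfl⟩ : ∃ k, A = B * k := ⟨B⁻¹ * A, (mul_inv_cancel_left _ _).symm⟩
  have hk := act_basePt_eq_self_iff.1 (act_inv_mul_eq hpt)
  have hcomm := pauli_dact_basePt_mul hk ![0, 0, 1]
  rw [dact_inv_mul_eq hpt h] at hcomm
  rw [inv_mul_cancel_left] at hk hcomm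
  have h01 : k.1 0 1 = 0 := self_eq_neg.1 <| by
    simpa [pauli, Matrix.mul_apply] using congrFun₂ hcomm 0 1
  have h10 : k.1 1 0 = 0 := neg_eq_self.1 <| by
    simpa [pauli, Matrix.mul_apply] using congrFun₂ hcomm 1 0
  obtain ⟨u, rfl⟩ := eq_torus_of_offDiag_eq_zero h01 h10
  refine ⟨u, ?_, rfl⟩
  have h00 : (u : ℂ) * star (u : ℂ) = 1 := by
    simpa [coe_torus, Matrix.mul_apply] using congrFun₂ hk 0 0
  exact_mod_cast (Complex.mul_conj (u : ℂ)).symm.trans h00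

theorem torus_neg (u : ℂˣ) : torus (-u) = -torus u :=
  Subtype.ext (by rw [coe_neg, coe_torus, coe_torus]; simp [inv_neg])

theorem eq_or_eq_neg_of_dact_eq {A B : SL2C} (hpt : act A basePt = act B basePt)
    (h1 : dact A basePt ![0, 0, 1] = dact B basePt ![0, 0, 1])
    (h2 : dact A basePt ![0, 1, 0] = dact B basePt ![0, 1, 0]) : A = B ∨ A = -B := by
  obtain ⟨u, -, rfl⟩ := exists_eq_mul_torus_of_dact_eq hpt h1
  have hk := act_basePt_eq_self_iff.1 (act_inv_mul_eq hpt)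
  have hcomm := pauli_dact_basePt_mul hk ![0, 1, 0]
  rw [dact_inv_mul_eq hpt h2, inv_mul_cancel_left] at hcomm
  have hinv : (u : ℂ)⁻¹ = u := by
    simpa [pauli, coe_torus, Matrix.mul_apply, mul_comm] using congrFun₂ hcomm 0 1
  rcases u.inv_eq_self_iff.1 (Units.ext (by simpa using hinv)) with rfl | rfl
  · exact .inl (by rw [map_one, mul_one])
  · exact .inr (by rw [torus_neg, map_one, mul_neg, mul_one])

theorem eq_one_or_eq_neg_one_of_act_eq {M : SL2C} (h : ∀ x : Space, 0 < x 2 → act M x = x) :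
    M = 1 ∨ M = -1 := by
  have hdact (u : Space) : dact M basePt u = dact 1 basePt u := by
    rw [dact_one basePt_pos, dact_eq_of_hasFDerivAt (hasFDerivAt_id _) h basePt_pos]
    rfl
  have hpt : act M basePt = act 1 basePt := by
    rw [h _ basePt_pos, act_one basePt_pos]
  exact eq_or_eq_neg_of_dact_eq hpt (hdact _) (hdact _)

/-! ### Screw motions and geodesics -/

theorem continuous_of_continuous_entries {X : Type*} [TopologicalSpace X] {F : X → SL2C}
    (h : ∀ i j, Continuous fun x => (F x).1 i j) : Continuous F :=
  continuous_induced_rng.2 (continuous_matrix h)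

theorem eq_of_eq_one_or_eq_neg_one {X : Type*} [TopologicalSpace X] [PreconnectedSpace X]
    {F : X → SL2C} (hF : Continuous F) (h : ∀ x, F x = 1 ∨ F x = -1) (x y : X) : F x = F y := by
  have : DiscreteTopology ({1, -1} : Set SL2C) := (Set.toFinite _).isDiscrete.to_subtype
  exact congrArg Subtype.val (PreconnectedSpace.constant (Y := ({1, -1} : Set SL2C))
    inferInstance (hF.subtype_mk h))

/-- The matrix `diag(e^(d/2), e^(-d/2))`, the spin lift of the screw motion `screw d`. -/
def expTorus (d : ℂ) : SL2C := torus (Units.mk0 (Complex.exp (d / 2)) (Complex.exp_ne_zero _))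

theorem expTorus_zero : expTorus 0 = 1 :=
  (congrArg torus (Units.ext (by simp))).trans (map_one torus)

theorem continuous_expTorus : Continuous expTorus := by
  have hexp : Continuous fun d : ℂ => Complex.exp (d / 2) := by fun_prop
  refine continuous_of_continuous_entries fun i j => ?_
  fin_cases i <;> fin_cases j
  exacts [hexp, continuous_const, continuous_const, hexp.inv₀ fun _ => Complex.exp_ne_zero _]

theorem act_expTorus (d : ℂ) {x : Space} (hx : 0 < x 2) : act (expTorus d) x = screw d x := by
  have hsq : Complex.exp (d / 2) ^ 2 = Complex.exp d := by
    rw [← Complex.exp_nat_mul]; congr 1; push_cast; ring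
  have hnorm : Complex.normSq (Complex.exp (d / 2)) = Real.exp d.re := by
    rw [Complex.normSq_eq_norm_sq, ← norm_pow, hsq, Complex.norm_exp]
  obtain ⟨z, t, rfl⟩ : ∃ z t, x = upperPt z t := ⟨_, _, eq_upperPt x⟩
  rw [expTorus, act_torus _ _ (show 0 < t from hx), Units.val_mk0, hsq, hnorm]
  simp [screw, upperPt, Complex.re_add_im]

theorem isSpinScrew_iff {A B : SL2C} {d : ℂ} :
    IsSpinScrew A d B ↔ B = A * expTorus d * A⁻¹ := by
  set P : unitInterval → SL2C := fun t => A * expTorus (((t : ℝ) : ℂ) * d) * A⁻¹ with hP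
  have hP0 : P 0 = 1 := by simp [hP, expTorus_zero]
  have hP1 : P 1 = A * expTorus d * A⁻¹ := by simp [hP]
  have hcont : Continuous P :=
    (continuous_const.mul (continuous_expTorus.comp (by fun_prop))).mul continuous_const
  have hact (t : unitInterval) (x : Space) (hx : 0 < x 2) :
      act (P t) x = act A (screw (((t : ℝ) : ℂ) * d) (act A⁻¹ x)) := by
    rw [act_mul _ _ hx, act_mul _ _ (act_pos _ hx), act_expTorus _ (act_pos _ hx)]
  constructor
  · rintro ⟨M, hM, hM0, rfl, hMact⟩
    have hsign (t : unitInterval) : (P t)⁻¹ * M t = 1 ∨ (P t)⁻¹ * M t = -1 :=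
      eq_one_or_eq_neg_one_of_act_eq fun x hx => by
        rw [act_mul _ _ hx, hMact t x hx, ← hact t x hx, ← act_mul _ _ hx, inv_mul_cancel,
          act_one hx]
    have h : (P 1)⁻¹ * M 1 = (P 0)⁻¹ * M 0 :=
      eq_of_eq_one_or_eq_neg_one (hcont.inv.mul hM) hsign 1 0
    rw [hP0, hM0, mul_one, inv_one, inv_mul_eq_one] at h
    rw [← h, hP1]
  · rintro rfl
    exact ⟨P, hcont, hP0, hP1, hact⟩

theorem geod_mul_torus (A : SL2C) (u : ℂˣ) (t : ℝ) :
    geod (A * torus u) t = geod A (t + Real.log (Complex.normSq u)) := by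
  have hu : 0 < Complex.normSq u := Complex.normSq_pos.2 u.ne_zero
  have hpt : (![0, 0, Real.exp t] : Space) = upperPt 0 (Real.exp t) := rfl
  rw [geod, geod, hpt, act_mul _ _ (Real.exp_pos t), act_torus _ _ (Real.exp_pos t), mul_zero,
    Real.exp_add, Real.exp_log hu, mul_comm]
  rfl

theorem geod_zero (A : SL2C) : geod A 0 = act A basePt := by rw [geod, Real.exp_zero, basePt]

theorem deriv_geod_zero (A : SL2C) : deriv (geod A) 0 = dact A basePt ![0, 0, 1] := by
  have hvert : HasDerivAt (fun t : ℝ => (![0, 0, Real.exp t] : Space)) ![0, 0, 1] 0 := by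
    refine hasDerivAt_pi.2 fun i => ?_
    fin_cases i
    exacts [hasDerivAt_const _ _, hasDerivAt_const _ _, by simpa using Real.hasDerivAt_exp 0]
  have hbase : (![0, 0, Real.exp 0] : Space) = basePt := by rw [Real.exp_zero, basePt]
  have hA : HasFDerivAt (act A) (dact A basePt) ![0, 0, Real.exp 0] :=
    hbase ▸ hasFDerivAt_dact A (x := basePt) basePt_pos
  exact (hA.comp_hasDerivAt _ hvert).deriv

theorem isAdapted_iff {A s : SL2C} : IsAdapted A s ↔ ∃ u : ℂˣ, s = A * torus u := by
  have hgeod (u : ℂˣ) : geod A (Real.log (Complex.normSq u)) = act (A * torus u) basePt ∧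
      deriv (geod A) (Real.log (Complex.normSq u)) = dact (A * torus u) basePt ![0, 0, 1] := by
    constructor
    · rw [← geod_zero, geod_mul_torus, zero_add]
    · rw [← deriv_geod_zero, funext (geod_mul_torus A u), deriv_comp_add_const, zero_add]
  constructor
  · rintro ⟨t, hpt, hdir⟩
    obtain ⟨v, rfl⟩ : ∃ v : ℂˣ, Real.log (Complex.normSq v) = t :=
      ⟨realUnit _ (Real.exp_pos (t / 2)), by
        rw [realUnit, Units.val_mk0, Complex.normSq_ofReal, ← Real.exp_add, add_halves,
          Real.log_exp]⟩
    obtain ⟨u, -, rfl⟩ := exists_eq_mul_torus_of_dact_eq (hpt.trans (hgeod v).1)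
      (hdir.trans (hgeod v).2)
    exact ⟨v * u, by rw [map_mul, mul_assoc]⟩
  · rintro ⟨u, rfl⟩
    exact ⟨_, (hgeod u).1.symm, (hgeod u).2.symm⟩

theorem act_basePt_mem_range_geod (A : SL2C) : act A basePt ∈ Set.range (geod A) :=
  ⟨0, geod_zero A⟩

theorem act_mul_torus_basePt_mem_range_geod (A : SL2C) (u : ℂˣ) :
    act (A * torus u) basePt ∈ Set.range (geod A) :=
  ⟨_, (geod_mul_torus A u 0).symm.trans (geod_zero _)⟩

theorem isComplexDistance_iff {A s₁ s₂ : SL2C} {d : ℂ} :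
    IsComplexDistance A s₁ s₂ d ↔ (∃ u, s₁ = A * torus u) ∧ s₂ = s₁ * expTorus d := by
  rw [IsComplexDistance, isAdapted_iff, isAdapted_iff]
  have hconj (u : ℂˣ) : A * expTorus d * A⁻¹ * (A * torus u) = A * torus u * expTorus d := by
    rw [expTorus, mul_assoc, inv_mul_cancel_left, mul_assoc, mul_assoc, ← map_mul, ← map_mul,
      mul_comm u]
  constructor
  · rintro ⟨⟨u, rfl⟩, -, B, hB, rfl⟩
    exact ⟨⟨u, rfl⟩, by rw [isSpinScrew_iff.1 hB, hconj]⟩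
  · rintro ⟨⟨u, rfl⟩, rfl⟩
    exact ⟨⟨u, rfl⟩, ⟨_, by rw [mul_assoc, expTorus, ← map_mul]⟩, _, isSpinScrew_iff.2 rfl,
      (hconj u).symm⟩

/-! ### Rotation by `π` about the second vector of a frame -/

/-- A spin lift of the rotation by `π` about the second vector of the base frame. -/
def halfTurn : SL2C := ⟨!![0, -1; 1, 0], by simp [det_fin_two_of]⟩

/-- A spin lift of a rotation taking the first vector of the base frame to the second. -/
def axisTurn : SL2C :=
  ⟨(1 / 2 : ℂ) • !![1 + Complex.I, -1 - Complex.I; 1 - Complex.I, 1 - Complex.I], by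
    rw [det_smul, det_fin_two_of, Fintype.card_fin]
    linear_combination (-1 / 2 : ℂ) * Complex.I_sq⟩

theorem halfTurn_unitary : halfTurn.1 * halfTurn.1ᴴ = 1 := by
  ext i j
  fin_cases i <;> fin_cases j <;> simp [halfTurn, Matrix.mul_apply]

theorem axisTurn_unitary : axisTurn.1 * axisTurn.1ᴴ = 1 := by
  ext i j
  fin_cases i <;> fin_cases j <;> apply Complex.ext <;>
    simp [axisTurn, Matrix.mul_apply] <;> norm_num

theorem dact_halfTurn (u : Space) : dact halfTurn basePt u = ![-u 0, u 1, -u 2] := by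
  refine pauli_injective ?_
  rw [pauli_dact_basePt halfTurn_unitary]
  ext i j
  fin_cases i <;> fin_cases j <;> simp [pauli, halfTurn, Matrix.mul_apply] <;> ring

theorem dact_axisTurn : dact axisTurn basePt ![0, 0, 1] = ![0, 1, 0] := by
  refine pauli_injective ?_
  rw [pauli_dact_basePt axisTurn_unitary]
  ext i j
  fin_cases i <;> fin_cases j <;> apply Complex.ext <;>
    simp [pauli, axisTurn, Matrix.mul_apply] <;> norm_num

theorem axisTurn_mul_expTorus : axisTurn * expTorus (Real.pi * Complex.I) =
    halfTurn * axisTurn := by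
  have hexp : Complex.exp (Real.pi * Complex.I / 2) = Complex.I := by
    rw [mul_div_right_comm, Complex.exp_pi_div_two_mul_I]
  refine Subtype.ext ?_
  rw [coe_mul, coe_mul, expTorus, coe_torus, Units.val_mk0, hexp]
  ext i j
  fin_cases i <;> fin_cases j <;> apply Complex.ext <;>
    simp [axisTurn, halfTurn, Matrix.mul_apply]

theorem isSpinRotation_pi_iff {W s s' : SL2C} :
    IsSpinRotation (act W basePt) (dact W basePt ![0, 1, 0]) Real.pi s s' ↔
      s' = W * halfTurn * W⁻¹ * s := by
  have hpt : act (W * axisTurn) basePt = act W basePt := by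
    rw [act_mul _ _ basePt_pos, act_basePt_eq_self_iff.2 axisTurn_unitary]
  have hdir : dact (W * axisTurn) basePt ![0, 0, 1] = dact W basePt ![0, 1, 0] := by
    rw [dact_mul _ _ basePt_pos, act_basePt_eq_self_iff.2 axisTurn_unitary, dact_axisTurn]
  have hconj (u : ℂˣ) : W * axisTurn * torus u * expTorus (Real.pi * Complex.I) *
      (W * axisTurn * torus u)⁻¹ = W * halfTurn * W⁻¹ := by
    have hcomm : torus u * expTorus (Real.pi * Complex.I) =
        expTorus (Real.pi * Complex.I) * torus u := by
      rw [expTorus, ← map_mul, ← map_mul, mul_comm]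
    rw [mul_assoc (W * axisTurn), hcomm, ← mul_assoc, mul_assoc W, axisTurn_mul_expTorus]
    group
  constructor
  · rintro ⟨A, B, hA, hAdir, hAB, rfl⟩
    obtain ⟨u, -, rfl⟩ := exists_eq_mul_torus_of_dact_eq (hA.trans hpt.symm)
      (hAdir.trans hdir.symm)
    rw [isSpinScrew_iff.1 hAB, hconj]
  · rintro rfl
    refine ⟨W * axisTurn, _, hpt, hdir, isSpinScrew_iff.2 ?_, rfl⟩
    simpa using (hconj 1).symm

/-! ### Spinors and horospheres -/


theorem toHyperboloid_act_basePt (A : SL2C) : toHyperboloid (act A basePt) = actM A hypBase := by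
  rw [toHyperboloid_act A basePt_pos, toHyperboloid_basePt]

theorem col_mul (A B : SL2C) (j : Fin 2) : (A * B).1.col j = A.1 *ᵥ B.1.col j := by
  rw [coe_mul, ← mulVec_single_one, ← mulVec_mulVec, mulVec_single_one]

theorem col_zero_ne_zero (A : SL2C) : A.1.col 0 ≠ 0 := fun h => by
  have hdet := A.2
  have h0 : A.1 0 0 = 0 := congrFun h 0
  have h1 : A.1 1 0 = 0 := congrFun h 1
  rw [det_fin_two, h0, h1, zero_mul, mul_zero, sub_zero] at hdet
  exact zero_ne_one hdet

theorem spinorDet_col (A B : SL2C) : spinorDet (A.1.col 0) (B.1.col 0) = (A⁻¹ * B).1 1 0 := by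
  simp only [spinorDet, col_apply, coe_mul, Matrix.SpecialLinearGroup.coe_inv, adjugate_fin_two,
    Matrix.mul_apply, Fin.sum_univ_two, of_apply, cons_val', cons_val_zero, cons_val_one,
    cons_val_fin_one]
  ring

theorem col_zero_mul_unipotent (A : SL2C) (w : ℂ) : (A * unipotent w).1.col 0 = A.1.col 0 := by
  ext i
  simp [coe_unipotent, Matrix.mul_apply]

/-- The squared Hermitian norm `|ξ|² + |η|²` of a spinor. -/
def spinorNormSq (κ : Spinor) : ℝ := Complex.normSq (κ 0) + Complex.normSq (κ 1)

theorem spinorNormSq_pos {κ : Spinor} (hκ : κ ≠ 0) : 0 < spinorNormSq κ := by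
  obtain ⟨i, hi⟩ := Function.ne_iff.1 hκ
  have hpos := Complex.normSq_pos.2 hi
  fin_cases i
  · exact add_pos_of_pos_of_nonneg hpos (Complex.normSq_nonneg _)
  · exact add_pos_of_nonneg_of_pos (Complex.normSq_nonneg _) hpos

theorem ofReal_spinorNormSq (κ : Spinor) :
    (spinorNormSq κ : ℂ) = κ 0 * star (κ 0) + κ 1 * star (κ 1) := by
  simp [spinorNormSq, Complex.mul_conj]

/-- The special linear matrix with orthogonal columns and first column `κ`: a continuous section
of `A ↦ A.col 0`. -/
def ofSpinor (κ : {κ : Spinor // κ ≠ 0}) : SL2C :=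
  ⟨!![κ.1 0, -star (κ.1 1) / spinorNormSq κ.1; κ.1 1, star (κ.1 0) / spinorNormSq κ.1], by
    have hne : (spinorNormSq κ.1 : ℂ) ≠ 0 := Complex.ofReal_ne_zero.2 (spinorNormSq_pos κ.2).ne'
    rw [det_fin_two_of, ← div_self hne, ofReal_spinorNormSq]
    ring⟩

theorem col_zero_ofSpinor (κ : {κ : Spinor // κ ≠ 0}) : (ofSpinor κ).1.col 0 = κ.1 := by
  ext i
  fin_cases i <;> rfl

theorem col_one_eq (W : SL2C) : W.1.col 1 =
    ((2 : ℂ) • gInv (toHyperboloid (act W basePt))) *ᵥ ![-star (W.1 1 0), star (W.1 0 0)] := by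
  have hdet := W.2
  rw [det_fin_two] at hdet
  have h : W.1ᴴ *ᵥ ![-star (W.1 1 0), star (W.1 0 0)] = Pi.single 1 1 := by
    ext i
    fin_cases i
    · simp [mulVec, dotProduct, mul_comm]
    · simp only [mulVec, dotProduct, conjTranspose_apply, Fin.sum_univ_two, Fin.mk_one,
        cons_val_zero, cons_val_one, Pi.single_eq_same]
      simpa [sub_eq_neg_add, mul_comm] using congrArg star hdet
  rw [toHyperboloid_act_basePt, gInv_actM_hypBase, smul_smul, mul_one_div_cancel two_ne_zero,
    one_smul, ← mulVec_mulVec, h, mulVec_single_one]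

theorem eq_of_col_zero_eq {A B : SL2C} (hcol : A.1.col 0 = B.1.col 0)
    (hpt : act A basePt = act B basePt) : A = B := by
  refine Subtype.ext (Matrix.ext_col fun j => ?_)
  have h0 : A.1 0 0 = B.1 0 0 := congrFun hcol 0
  have h1 : A.1 1 0 = B.1 1 0 := congrFun hcol 1
  fin_cases j
  · exact hcol
  · exact (col_one_eq A).trans (by rw [hpt, h0, h1]; exact (col_one_eq B).symm)

/-- The point `g(f(κ))` of the light cone representing the horosphere of the spinor `κ`. -/
def conePt (κ : Spinor) : Mink := g (f κ)

/-- The point of the light cone of the spinor `(1, 0)`, which represents the horosphere at height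
`1`. -/
def coneBase : Mink := ![1, 0, 0, 1]

theorem gInv_conePt (κ : Spinor) : gInv (conePt κ) = vecMulVec κ (star κ) := gInv_g _

theorem conePt_mulVec (A : SL2C) (κ : Spinor) : conePt (A.1 *ᵥ κ) = actM A (conePt κ) :=
  gInv_injective <| by
    rw [gInv_actM, gInv_conePt, gInv_conePt, mul_vecMulVec, vecMulVec_mul, star_mulVec]

theorem conePt_single : conePt (Pi.single 0 1) = coneBase := by
  ext k
  fin_cases k <;> simp [conePt, g, f, vecMulVec_apply, coneBase]

theorem conePt_col_zero (A : SL2C) : conePt (A.1.col 0) = actM A coneBase := by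
  rw [← mulVec_single_one, conePt_mulVec, conePt_single]

theorem exists_unipotent_of_mem_horoH {x : Mink} (hx : x ∈ horoH coneBase) :
    ∃ w, x = actM (unipotent w) hypBase := by
  have h1 : x 0 - x 3 = 1 := by simpa [mform, coneBase] using hx.2
  refine ⟨⟨x 1, x 2⟩, toUpper_injOn hx.1 (actM_hypBase_mem _) ?_⟩
  have hbase : basePt = upperPt 0 1 := rfl
  rw [← act_basePt, hbase, act_unipotent _ _ one_pos, toUpper_apply hx.1, h1, inv_one, one_smul,
    zero_add]
  rfl

theorem actM_hypBase_mem_horoH (W : SL2C) : actM W hypBase ∈ horoH (conePt (W.1.col 0)) := by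
  refine ⟨actM_hypBase_mem W, ?_⟩
  rw [conePt_col_zero, mform_actM]
  simp [mform, hypBase, coneBase]

theorem mem_horoH_conePt {κ : Spinor} (hκ : κ ≠ 0) {x : Mink} :
    x ∈ horoH (conePt κ) ↔ ∃ W : SL2C, W.1.col 0 = κ ∧ x = actM W hypBase := by
  constructor
  · rintro ⟨hx, hxp⟩
    obtain ⟨W, hW⟩ : ∃ W : SL2C, W.1.col 0 = κ := ⟨_, col_zero_ofSpinor ⟨κ, hκ⟩⟩
    rw [← hW, conePt_col_zero, ← actM_actM_inv W x, mform_actM] at hxp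
    obtain ⟨w, hw⟩ := exists_unipotent_of_mem_horoH ⟨actM_mem hx, hxp⟩
    exact ⟨W * unipotent w, (col_zero_mul_unipotent W w).trans hW,
      by rw [actM_mul, ← hw, actM_actM_inv]⟩
  · rintro ⟨W, rfl, rfl⟩
    exact actM_hypBase_mem_horoH W

theorem K_carrier (κ : Spinor) : (K κ).carrier = toUpper '' horoH (conePt κ) :=
  Set.image_image _ _ _

theorem mem_K_carrier {κ : Spinor} (hκ : κ ≠ 0) {q : Space} :
    q ∈ (K κ).carrier ↔ ∃ W : SL2C, W.1.col 0 = κ ∧ act W basePt = q := by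
  rw [K_carrier]
  constructor
  · rintro ⟨x, hx, rfl⟩
    obtain ⟨W, hW, rfl⟩ := (mem_horoH_conePt hκ).1 hx
    exact ⟨W, hW, act_basePt W⟩
  · rintro ⟨W, hW, rfl⟩
    exact ⟨_, (mem_horoH_conePt hκ).2 ⟨W, hW, rfl⟩, (act_basePt W).symm⟩

theorem act_basePt_mem_K (W : SL2C) : act W basePt ∈ (K (W.1.col 0)).carrier :=
  (mem_K_carrier (col_zero_ne_zero W)).2 ⟨W, rfl, rfl⟩

theorem eq_coneBase_of_horoH_subset {p : Mink} (h : horoH coneBase ⊆ horoH p) : p = coneBase := by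
  have hpoint (a b : ℝ) : (1 + (a ^ 2 + b ^ 2) / 2) * p 0 - a * p 1 - b * p 2 -
      (a ^ 2 + b ^ 2) / 2 * p 3 = 1 := by
    refine (h (a := ![1 + (a ^ 2 + b ^ 2) / 2, a, b, (a ^ 2 + b ^ 2) / 2]) ⟨⟨?_, ?_⟩, ?_⟩).2
    · simp [mform]; ring
    · simp only [cons_val_zero]; positivity
    · simp [mform, coneBase]
  have h00 := hpoint 0 0
  have h10 := hpoint 1 0
  have h10' := hpoint (-1) 0
  have h01 := hpoint 0 1
  ext k
  fin_cases k <;> simp [coneBase] <;> linarith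

theorem horoH_actM (A : SL2C) (p : Mink) : horoH (actM A p) = actM A '' horoH p := by
  ext x
  constructor
  · rintro ⟨hx, hxp⟩
    refine ⟨actM A⁻¹ x, ⟨actM_mem hx, ?_⟩, actM_actM_inv A x⟩
    rwa [← mform_actM A, actM_actM_inv]
  · rintro ⟨y, ⟨hy, hyp⟩, rfl⟩
    exact ⟨actM_mem hy, by rwa [mform_actM]⟩

theorem eq_conePt_of_horoH_eq {κ : Spinor} (hκ : κ ≠ 0) {p : Mink}
    (h : horoH p = horoH (conePt κ)) : p = conePt κ := by
  obtain ⟨W, rfl⟩ : ∃ W : SL2C, W.1.col 0 = κ := ⟨_, col_zero_ofSpinor ⟨κ, hκ⟩⟩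
  have hbase : actM W⁻¹ p = coneBase := by
    refine eq_coneBase_of_horoH_subset ?_
    rw [horoH_actM, h, ← horoH_actM, conePt_col_zero, actM_inv_actM]
  rw [conePt_col_zero, ← hbase, actM_actM_inv]

theorem cone_eq_conePt {κ : Spinor} (hκ : κ ≠ 0) {h : Horosphere}
    (hh : h.carrier = (K κ).carrier) : h.cone = conePt κ := by
  refine eq_conePt_of_horoH_eq hκ ((toUpper_injOn.image_eq_image_iff
    (fun _ hx => hx.1) (fun _ hx => hx.1)).1 ?_)
  rw [← K_carrier, ← hh]
  exact h.isHoro.choose_spec.2.symm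

theorem conePt_zero (κ : Spinor) : conePt κ 0 = spinorNormSq κ := by
  simp [conePt, g, f, vecMulVec_apply, spinorNormSq, Complex.normSq_apply]

theorem conePt_mem_lightCone {κ : Spinor} (hκ : κ ≠ 0) : conePt κ ∈ lightCone := by
  refine ⟨Complex.ofReal_injective ?_, (conePt_zero κ).symm ▸ spinorNormSq_pos hκ⟩
  rw [mform_self, gInv_conePt, det_vecMulVec, mul_zero, Complex.ofReal_zero]

open Classical in
/-- The boundary point `ξ / η` of a spinor `(ξ, η)`. -/
def spinorBdry (κ : Spinor) : OnePoint ℂ :=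
  if κ 1 = 0 then OnePoint.infty else ((κ 0 / κ 1 : ℂ) : OnePoint ℂ)

theorem boundaryPt_conePt {κ : Spinor} (hκ : κ ≠ 0) : boundaryPt (conePt κ) = spinorBdry κ := by
  have hpos : 0 < conePt κ 0 := (conePt_mem_lightCone hκ).2
  have hne : (conePt κ 0 : ℂ) ≠ 0 := Complex.ofReal_ne_zero.2 hpos.ne'
  have h11 : ((conePt κ 0 - conePt κ 3) / 2 : ℂ) = κ 1 * star (κ 1) :=
    congrFun (congrFun (gInv_conePt κ) 1) 1
  have h01 : ((conePt κ 1 + conePt κ 2 * Complex.I) / 2 : ℂ) = κ 0 * star (κ 1) :=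
    congrFun (congrFun (gInv_conePt κ) 0) 1
  have hinfty : conePt κ 3 / conePt κ 0 = 1 ↔ κ 1 = 0 := by
    rw [div_eq_one_iff_eq hpos.ne', eq_comm, ← sub_eq_zero, ← Complex.ofReal_eq_zero,
      Complex.ofReal_sub, ← div_left_inj' two_ne_zero, h11, zero_div, mul_eq_zero, star_eq_zero,
      or_self]
  rw [boundaryPt, spinorBdry]
  simp only [hinfty]
  split_ifs with h
  · rfl
  · have hsub : (1 - ((conePt κ 3 / conePt κ 0 : ℝ) : ℂ)) =
        2 * (κ 1 * star (κ 1)) / conePt κ 0 := by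
      rw [← h11, Complex.ofReal_div]; field_simp
    have hadd : (((conePt κ 1 / conePt κ 0 : ℝ) : ℂ) +
        ((conePt κ 2 / conePt κ 0 : ℝ) : ℂ) * Complex.I) = 2 * (κ 0 * star (κ 1)) / conePt κ 0 := by
      rw [← h01, Complex.ofReal_div, Complex.ofReal_div]; field_simp
    have hstar : star (κ 1) ≠ 0 := star_ne_zero.2 h
    rw [hsub, hadd]
    congr 1
    field_simp

theorem centre_eq_spinorBdry {κ : Spinor} (hκ : κ ≠ 0) {h : Horosphere}
    (hh : h.carrier = (K κ).carrier) : h.centre = spinorBdry κ := by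
  rw [Horosphere.centre, cone_eq_conePt hκ hh, boundaryPt_conePt hκ]

theorem spinorBdry_eq_iff {κ κ' : Spinor} (hκ : κ ≠ 0) (hκ' : κ' ≠ 0) :
    spinorBdry κ = spinorBdry κ' ↔ spinorDet κ κ' = 0 := by
  have ne_zero {κ : Spinor} (hκ : κ ≠ 0) (h1 : κ 1 = 0) : κ 0 ≠ 0 := fun h0 =>
    hκ (funext (Fin.forall_fin_two.2 ⟨h0, h1⟩))
  rw [spinorBdry, spinorBdry, spinorDet]
  split_ifs with h1 h2 h2
  · simp [h1, h2]
  · simp [h1, h2, ne_zero hκ h1]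
  · simp [h1, h2, ne_zero hκ' h2]
  · rw [OnePoint.coe_eq_coe, div_eq_div_iff h1 h2, sub_eq_zero]

theorem actBoundary_infty (A : SL2C) : actBoundary A OnePoint.infty = spinorBdry (A.1.col 0) := by
  rw [actBoundary, OnePoint.smul_infty_eq_ite, spinorBdry]
  rfl

theorem actBoundary_zero (A : SL2C) :
    actBoundary A ((0 : ℂ) : OnePoint ℂ) = spinorBdry (A.1.col 1) := by
  rw [actBoundary, OnePoint.smul_some_eq_ite, spinorBdry]
  simp only [mul_zero, zero_add]
  rfl

theorem mem_horoTangentH {W : SL2C} {v : Mink} :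
    v ∈ horoTangentH (conePt (W.1.col 0)) (actM W hypBase) ↔
      ∃ s t : ℝ, v = actM W (tangentBase ![s, t, 0]) := by
  rw [← actM_actM_inv W v, conePt_col_zero, horoTangentH, Set.mem_ofPred_eq, mform_actM, mform_actM,
    mform_hypBase_eq_zero_iff]
  constructor
  · rintro ⟨⟨u, hu⟩, hcone⟩
    rw [hu] at hcone ⊢
    have hu2 : u 2 = 0 := by simpa [mform, coneBase, tangentBase] using hcone
    exact ⟨u 0, u 1, by rw [← hu2]; rfl⟩
  · rintro ⟨s, t, h⟩
    have hv : actM W⁻¹ v = tangentBase ![s, t, 0] := by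
      rw [← actM_inv_actM W (tangentBase _), ← h, actM_actM_inv]
    exact ⟨⟨_, hv⟩, by rw [hv]; simp [mform, coneBase, tangentBase]⟩

theorem mem_tangent_act_basePt {W : SL2C} {h : Horosphere}
    (hh : h.carrier = (K (W.1.col 0)).carrier) {v : Space} :
    v ∈ h.tangent (act W basePt) ↔ ∃ s t : ℝ, v = dact W basePt ![s, t, 0] := by
  change v ∈ fderiv ℝ toUpper (toHyperboloid (act W basePt)) ''
    horoTangentH h.cone (toHyperboloid (act W basePt)) ↔ _
  rw [cone_eq_conePt (col_zero_ne_zero W) hh, toHyperboloid_act_basePt]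
  constructor
  · rintro ⟨u, hu, rfl⟩
    obtain ⟨s, t, rfl⟩ := mem_horoTangentH.1 hu
    exact ⟨s, t, (dact_basePt W _).symm⟩
  · rintro ⟨s, t, rfl⟩
    exact ⟨_, mem_horoTangentH.2 ⟨s, t, rfl⟩, (dact_basePt W _).symm⟩

theorem mform_add_right (x v w : Mink) : mform x (v + w) = mform x v + mform x w := by
  simp only [mform, Pi.add_apply]
  ring

theorem mform_smul_right (c : ℝ) (x v : Mink) : mform x (c • v) = c * mform x v := by
  simp only [mform, Pi.smul_apply, smul_eq_mul]
  ring

theorem exists_Zmap_eq (W : SL2C) : ∃ z : ℂ, Zmap (W.1.col 0) =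
    z • W.1.col 0 - (Complex.I * spinorNormSq (W.1.col 0)) • W.1.col 1 := by
  have hdet := W.2
  rw [det_fin_two] at hdet
  refine ⟨Complex.I * (star (W.1 1 0) * W.1 1 1 + star (W.1 0 0) * W.1 0 1), ?_⟩
  rw [ofReal_spinorNormSq]
  ext i
  fin_cases i <;> simp [Zmap]
  · linear_combination (-Complex.I * starRingEnd ℂ (W.1 1 0)) * hdet
  · linear_combination (Complex.I * starRingEnd ℂ (W.1 0 0)) * hdet

theorem exists_g_Df_eq (W : SL2C) : ∃ a r : ℝ, 0 < r ∧
    g (Df (W.1.col 0) (Zmap (W.1.col 0))) =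
      a • conePt (W.1.col 0) + r • actM W (tangentBase ![0, 1, 0]) := by
  obtain ⟨z, hz⟩ := exists_Zmap_eq W
  refine ⟨2 * z.re, 2 * spinorNormSq (W.1.col 0),
    mul_pos two_pos (spinorNormSq_pos (col_zero_ne_zero W)), gInv_injective ?_⟩
  have hre : ((2 * z.re : ℝ) : ℂ) = z + star z := (Complex.add_conj z).symm
  rw [gInv_g, gInv_add, gInv_smul, gInv_smul, gInv_conePt, gInv_actM, gInv_tangentBase, hre, hz]
  ext i j
  simp [Df, pauli, vecMulVec_apply, Matrix.mul_apply, Fin.sum_univ_two]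
  ring

theorem mem_flagH_dir {W : SL2C} {v : Mink} :
    v ∈ (flagH (flagG (flagF (W.1.col 0)))).dir (actM W hypBase) ↔
      ∃ c : ℝ, 0 < c ∧ v = c • actM W (tangentBase ![0, 1, 0]) := by
  obtain ⟨a, r, hr, hv⟩ := exists_g_Df_eq W
  constructor
  · rintro ⟨-, ⟨hx, -⟩, S, ⟨α, β, hβ, rfl⟩, rfl⟩
    have hg : g (α • f (W.1.col 0) + β • Df (W.1.col 0) (Zmap (W.1.col 0))) =
        (α + β * a) • conePt (W.1.col 0) + (β * r) • actM W (tangentBase ![0, 1, 0]) := by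
      rw [map_add, map_smul, map_smul, hv, ← conePt]
      module
    have htangent : mform (actM W hypBase) (actM W (tangentBase ![0, 1, 0])) = 0 := by
      rw [mform_actM]
      exact mform_hypBase_eq_zero_iff.2 ⟨_, rfl⟩
    refine ⟨β * r, mul_pos hβ hr, ?_⟩
    change mform _ (g _) = 0 at hx
    rw [hg, mform_add_right, mform_smul_right, mform_smul_right, htangent,
      (actM_hypBase_mem_horoH W).2, mul_zero, add_zero, mul_one] at hx
    rw [hg, hx, zero_smul, zero_add]
  · rintro ⟨c, hc, rfl⟩
    have hg : g ((-(c / r * a)) • f (W.1.col 0) + (c / r) • Df (W.1.col 0) (Zmap (W.1.col 0))) =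
        c • actM W (tangentBase ![0, 1, 0]) := by
      rw [map_add, map_smul, map_smul, hv, ← conePt]
      match_scalars <;> field_simp
      simp
    refine ⟨⟨_, ?_, hg⟩, mem_horoTangentH.2 ⟨0, c, ?_⟩, _, ⟨_, _, div_pos hc hr, rfl⟩, hg⟩
    · exact add_mem (Submodule.smul_mem _ _ (Submodule.subset_span (Set.mem_insert _ _)))
        (Submodule.smul_mem _ _ (Submodule.subset_span (Set.mem_insert_of_mem _ rfl)))
    · rw [← actM_smul]
      congr 1
      ext k
      fin_cases k <;> simp [tangentBase]

theorem mem_K_dir_toUpper {κ : Spinor} {x : Mink} (hx : x ∈ horoH (conePt κ)) {w : Space} :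
    w ∈ (K κ).dir (toUpper x) ↔
      ∃ v ∈ (flagH (flagG (flagF κ))).dir x, fderiv ℝ toUpper x v = w := by
  rw [(hasFDerivAt_toUpper hx.1).fderiv]
  constructor
  · rintro ⟨_, -, hyx, _, ⟨x', hx', rfl, v, hv, rfl⟩, rfl⟩
    obtain rfl := toUpper_injOn (show x' ∈ hyperboloid from hx'.1) hx.1 hyx
    exact ⟨v, hv, rfl⟩
  · rintro ⟨v, hv, rfl⟩
    exact ⟨_, ⟨x, hx, rfl⟩, rfl, _, ⟨x, hx, rfl, v, hv, rfl⟩, rfl⟩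

theorem mem_K_dir {W : SL2C} {w : Space} : w ∈ (K (W.1.col 0)).dir (act W basePt) ↔
    ∃ c : ℝ, 0 < c ∧ w = c • dact W basePt ![0, 1, 0] := by
  rw [act_basePt, mem_K_dir_toUpper (actM_hypBase_mem_horoH W), dact_basePt]
  simp only [mem_flagH_dir, ← map_smul]
  constructor
  · rintro ⟨_, ⟨c, hc, rfl⟩, rfl⟩
    exact ⟨c, hc, rfl⟩
  · rintro ⟨c, hc, rfl⟩
    exact ⟨_, ⟨c, hc, rfl⟩, rfl⟩

theorem exists_eq_torus_of_unitary {k : SL2C} (hk : k.1 * k.1ᴴ = 1) (h10 : k.1 1 0 = 0) :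
    ∃ u : ℂˣ, k = torus u := by
  refine eq_torus_of_offDiag_eq_zero ?_ h10
  have h11 : k.1 1 1 ≠ 0 := fun h => by
    have hdet := k.2
    rw [det_fin_two, h, h10, mul_zero, mul_zero, sub_zero] at hdet
    exact zero_ne_one hdet
  have h01 := congrFun (congrFun hk 0) 1
  simpa [Matrix.mul_apply, h10, h11] using h01

theorem dact_torus_of_unitary {u : ℂˣ} (hu : (torus u).1 * (torus u).1ᴴ = 1) :
    dact (torus u) basePt ![0, 0, 1] = ![0, 0, 1] := by
  have hcomm : Commute (torus u).1 (pauli ![0, 0, 1]) := by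
    ext i j
    fin_cases i <;> fin_cases j <;> simp [coe_torus, pauli, Matrix.mul_apply]
  refine pauli_injective ?_
  rw [pauli_dact_basePt hu, hcomm.eq, mul_assoc, hu, mul_one]

theorem isOutwardNormal_iff {W : SL2C} {h : Horosphere}
    (hh : h.carrier = (K (W.1.col 0)).carrier) {n : Space} :
    h.IsOutwardNormal (act W basePt) n ↔ n = dact W basePt ![0, 0, 1] := by
  rw [Horosphere.IsOutwardNormal, centre_eq_spinorBdry (col_zero_ne_zero W) hh]
  constructor
  · rintro ⟨-, -, A, hA, rfl, hcentre⟩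
    rw [actBoundary_infty, eq_comm, spinorBdry_eq_iff (col_zero_ne_zero W) (col_zero_ne_zero A),
      spinorDet_col] at hcentre
    have hfix : act (W⁻¹ * A) basePt = basePt := act_inv_mul_eq hA
    have hunitary := act_basePt_eq_self_iff.1 hfix
    obtain ⟨u, hu⟩ := exists_eq_torus_of_unitary hunitary hcentre
    obtain rfl : A = W * torus u := by rw [← hu, mul_inv_cancel_left]
    rw [hu] at hfix hunitary
    rw [dact_mul _ _ basePt_pos, hfix, dact_torus_of_unitary hunitary]
  · rintro rfl
    refine ⟨(isUnitAt_dact_basePt W).2 (by simp), fun v hv => ?_, W, rfl, rfl,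
      actBoundary_infty W⟩
    obtain ⟨s, t, rfl⟩ := (mem_tangent_act_basePt hh).1 hv
    rw [dotProduct_dact_basePt]
    simp [dotProduct, Fin.sum_univ_three]

/-- The spin-decorated horosphere `H` projects to the decorated horosphere `K κ`. -/
def LiesOverK (H : SpinDecoratedHorosphere) (κ : Spinor) : Prop :=
  H.carrier = (K κ).carrier ∧ ∀ (q : H.carrier) (w : Space),
    w ∈ (K κ).dir q ↔ ∃ c : ℝ, 0 < c ∧ w = c • (frameOf (H.Wout q)).e2

theorem eq_one_of_isUnitAt_smul {q v : Space} {c : ℝ} (hq : 0 < q 2) (hc : 0 < c)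
    (hv : IsUnitAt q v) (hcv : IsUnitAt q (c • v)) : c = 1 := by
  rw [IsUnitAt, smul_dotProduct, dotProduct_smul, hv, smul_smul, smul_eq_mul,
    mul_eq_right₀ (pow_ne_zero 2 hq.ne')] at hcv
  nlinarith

theorem dact_Wout_eq {H : SpinDecoratedHorosphere} {W : SL2C} (hH : LiesOverK H (W.1.col 0))
    {q : H.carrier} (hq : (q : Space) = act W basePt) (hpt : act (H.Wout q) basePt = q) :
    dact (H.Wout q) basePt ![0, 1, 0] = dact W basePt ![0, 1, 0] := by
  have hunit (A : SL2C) : IsUnitAt (act A basePt) (dact A basePt ![0, 1, 0]) :=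
    (isUnitAt_dact_basePt A).2 (by simp)
  obtain ⟨c, hc, hcW⟩ := (hH.2 q (dact W basePt ![0, 1, 0])).1
    (hq ▸ mem_K_dir.2 ⟨1, one_pos, (one_smul ℝ _).symm⟩)
  have hWout : IsUnitAt (act W basePt) (dact (H.Wout q) basePt ![0, 1, 0]) := by
    rw [← hq, ← hpt]
    exact hunit _
  have hone : c = 1 :=
    eq_one_of_isUnitAt_smul (act_basePt_pos W) hc hWout (hcW ▸ hunit W)
  rw [hcW, hone, one_smul]
  rfl

theorem Wout_eq_or_eq_neg {H : SpinDecoratedHorosphere} {W : SL2C}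
    (hH : LiesOverK H (W.1.col 0)) {q : H.carrier} (hq : (q : Space) = act W basePt) :
    H.Wout q = W ∨ H.Wout q = -W := by
  obtain ⟨V, -, hV⟩ := H.isSpinDecoration
  obtain ⟨N, hN, hout, -⟩ := hV q
  have hpt : act (H.Wout q) basePt = q := congrArg Frame.pt hout
  have hnormal : dact (H.Wout q) basePt ![0, 0, 1] = N := congrArg Frame.e1 hout
  rw [hq, isOutwardNormal_iff hH.1] at hN
  exact eq_or_eq_neg_of_dact_eq (hpt.trans hq) (hnormal.trans hN) (dact_Wout_eq hH hq hpt)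

theorem Win_eq_Wout_mul_halfTurn (H : SpinDecoratedHorosphere) (q : H.carrier) :
    H.Win q = H.Wout q * halfTurn := by
  obtain ⟨V, -, hV⟩ := H.isSpinDecoration
  obtain ⟨N, -, hout, -, hrot⟩ := hV q
  have hpt : act (H.Wout q) basePt = q := congrArg Frame.pt hout
  have hdir : dact (H.Wout q) basePt ![0, 1, 0] = V q := congrArg Frame.e2 hout
  rw [← hpt, ← hdir, isSpinRotation_pi_iff, inv_mul_cancel_right] at hrot
  exact hrot

/-! ### Existence of a continuous lift -/

theorem act_image_K (A W : SL2C) :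
    act A '' (K (W.1.col 0)).carrier = (K ((A * W).1.col 0)).carrier := by
  ext q
  rw [mem_K_carrier (col_zero_ne_zero _)]
  constructor
  · rintro ⟨_, hq, rfl⟩
    obtain ⟨W', hW', rfl⟩ := (mem_K_carrier (col_zero_ne_zero W)).1 hq
    exact ⟨A * W', by rw [col_mul, hW', ← col_mul], act_mul _ _ basePt_pos⟩
  · rintro ⟨W', hW', rfl⟩
    have hcol : (A⁻¹ * W').1.col 0 = W.1.col 0 := by
      rw [col_mul, hW', ← col_mul, inv_mul_cancel_left]
    refine ⟨act (A⁻¹ * W') basePt, hcol ▸ act_basePt_mem_K _, ?_⟩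
    rw [← act_mul _ _ basePt_pos, mul_inv_cancel_left]

/-- The horosphere of a nonzero spinor. -/
abbrev spinorHorosphere (κ : {κ : Spinor // κ ≠ 0}) : Horosphere where
  carrier := (K κ.1).carrier
  isHoro := ⟨conePt κ.1, conePt_mem_lightCone κ.2, K_carrier κ.1⟩

theorem spinorDet_eq_zero_of_K_carrier_eq {κ κ' : Spinor} (hκ : κ ≠ 0) (hκ' : κ' ≠ 0)
    (h : (K κ).carrier = (K κ').carrier) : spinorDet κ κ' = 0 := by
  rw [← spinorBdry_eq_iff hκ hκ', ← centre_eq_spinorBdry hκ (h := spinorHorosphere ⟨κ, hκ⟩) rfl,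
    centre_eq_spinorBdry hκ' h]

theorem apply_zero_zero_of_trace {B : SL2C} (h10 : B.1 1 0 = 0)
    (ht : B.1.trace = 2 ∨ B.1.trace = -2) : B.1 0 0 = 1 ∨ B.1 0 0 = -1 := by
  have hdet := B.2
  rw [det_fin_two, h10, mul_zero, sub_zero] at hdet
  rw [trace_fin_two] at ht
  refine ht.imp (fun ht => sub_eq_zero.1 ?_) fun ht => eq_neg_of_add_eq_zero_left ?_
  all_goals
    refine pow_eq_zero_iff two_ne_zero |>.1 ?_
    linear_combination B.1 0 0 * ht - hdet

theorem col_zero_mul_of_trace {A W : SL2C} (ht : A.1.trace = 2 ∨ A.1.trace = -2)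
    (hdet : spinorDet (W.1.col 0) ((A * W).1.col 0) = 0) :
    (A * W).1.col 0 = W.1.col 0 ∨ (A * W).1.col 0 = (-W).1.col 0 := by
  set B := W⁻¹ * (A * W) with hB
  have h10 : B.1 1 0 = 0 := by rwa [← spinorDet_col]
  have htrace : B.1.trace = A.1.trace := by
    rw [hB, coe_mul, trace_mul_comm, ← coe_mul, mul_inv_cancel_right]
  have hcol : (A * W).1.col 0 = B.1 0 0 • W.1.col 0 := by
    have hAW : A * W = W * B := by rw [hB, mul_inv_cancel_left]
    ext i
    simp [hAW, Matrix.mul_apply, h10, mul_comm]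
  rw [hcol]
  rcases apply_zero_zero_of_trace h10 (htrace ▸ ht) with h | h
  · exact Or.inl (by rw [h, one_smul])
  · exact Or.inr (by rw [h, neg_one_smul]; rfl)

theorem dact_mul_eq_of_act_image_K {A W W' : SL2C} (ht : A.1.trace = 2 ∨ A.1.trace = -2)
    (hA : act A '' (K (W.1.col 0)).carrier = (K (W.1.col 0)).carrier)
    (hcol : W'.1.col 0 = W.1.col 0) (hpt : act (A * W) basePt = act W' basePt) :
    dact (A * W) basePt = dact W' basePt := by
  have hdet : spinorDet (W.1.col 0) ((A * W).1.col 0) = 0 :=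
    spinorDet_eq_zero_of_K_carrier_eq (col_zero_ne_zero _) (col_zero_ne_zero _)
      (hA.symm.trans (act_image_K A W))
  rcases col_zero_mul_of_trace ht hdet with h | h
  · rw [eq_of_col_zero_eq (h.trans hcol.symm) hpt]
  · have hneg : (A * W).1.col 0 = (-W').1.col 0 := h.trans (congrArg Neg.neg hcol).symm
    rw [eq_of_col_zero_eq hneg (by rw [hpt, act_neg]), dact_neg]

theorem exists_outFrame (κ : {κ : Spinor // κ ≠ 0}) (q : (K κ.1).carrier) :
    ∃ W : SL2C, W.1.col 0 = κ.1 ∧ act W basePt = q := (mem_K_carrier κ.2).1 q.2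

/-- The outward spin frame at a point `q` of the horosphere of a spinor `κ`: the matrix with first
column `κ` taking the base point to `q`. -/
def outFrame (κ : {κ : Spinor // κ ≠ 0}) (q : (K κ.1).carrier) : SL2C :=
  (exists_outFrame κ q).choose

theorem col_zero_outFrame (κ : {κ : Spinor // κ ≠ 0}) (q : (K κ.1).carrier) :
    (outFrame κ q).1.col 0 = κ.1 := (exists_outFrame κ q).choose_spec.1

theorem act_outFrame (κ : {κ : Spinor // κ ≠ 0}) (q : (K κ.1).carrier) :
    act (outFrame κ q) basePt = q := (exists_outFrame κ q).choose_spec.2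

theorem pos_of_mem_K {κ : Spinor} {q : Space} (hq : q ∈ (K κ).carrier) : 0 < q 2 := by
  rw [K_carrier] at hq
  obtain ⟨x, hx, rfl⟩ := hq
  exact toUpper_pos hx.1

theorem continuous_gInv : Continuous gInv := by
  refine continuous_matrix fun i j => ?_
  fin_cases i <;> fin_cases j <;>
    simp only [gInv, of_apply, cons_val', cons_val_fin_one, cons_val_zero, cons_val_one,
      Fin.zero_eta, Fin.mk_one] <;>
    fun_prop

/-- The total space of the family of horospheres of nonzero spinors. -/
abbrev HorosphereBundle :=
  {z : {κ : Spinor // κ ≠ 0} × Space // z.2 ∈ (K z.1.1).carrier}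

theorem continuous_outFrame :
    Continuous fun z : HorosphereBundle => outFrame z.1.1 ⟨z.1.2, z.2⟩ := by
  have hκ (i) : Continuous fun z : HorosphereBundle => z.1.1.1 i :=
    (continuous_apply i).comp (continuous_subtype_val.comp (continuous_subtype_val.fst))
  have hgInv : Continuous fun z : HorosphereBundle => gInv (toHyperboloid z.1.2) :=
    continuous_gInv.comp <| continuous_iff_continuousAt.2 fun z =>
      ContinuousAt.comp (f := fun z : HorosphereBundle => z.1.2)
        (differentiableAt_toHyperboloid (pos_of_mem_K z.2)).continuousAt
        continuous_subtype_val.snd.continuousAt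
  have hcol_one (z : HorosphereBundle) : (outFrame z.1.1 ⟨z.1.2, z.2⟩).1.col 1 =
      ((2 : ℂ) • gInv (toHyperboloid z.1.2)) *ᵥ ![-star (z.1.1.1 1), star (z.1.1.1 0)] := by
    have hcol := col_zero_outFrame z.1.1 ⟨z.1.2, z.2⟩
    rw [col_one_eq, act_outFrame, ← congrFun hcol 0, ← congrFun hcol 1, col_apply, col_apply]
  refine continuous_of_continuous_entries fun i j => ?_
  fin_cases j
  · exact (hκ i).congr fun z => (congrFun (col_zero_outFrame z.1.1 ⟨z.1.2, z.2⟩) i).symm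
  · refine Continuous.congr ?_ fun z => (congrFun (hcol_one z) i).symm
    refine (continuous_apply i).comp ((hgInv.const_smul (2 : ℂ)).matrix_mulVec ?_)
    refine continuous_pi fun k => ?_
    fin_cases k
    · exact (hκ 1).star.neg
    · exact (hκ 0).star

theorem spinorHorosphere_carrier_eq (κ : {κ : Spinor // κ ≠ 0}) (q : (K κ.1).carrier) :
    (spinorHorosphere κ).carrier = (K ((outFrame κ q).1.col 0)).carrier := by
  rw [col_zero_outFrame]

theorem isUnitParallel_dact_outFrame (κ : {κ : Spinor // κ ≠ 0}) :
    (spinorHorosphere κ).IsUnitParallel fun q => dact (outFrame κ q) basePt ![0, 1, 0] := by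
  refine ⟨fun q => ⟨?_, ?_⟩, fun A ht hA q q' hq => ?_⟩ <;> beta_reduce
  · rw [← act_outFrame κ q]
    exact (mem_tangent_act_basePt (spinorHorosphere_carrier_eq κ q)).2 ⟨0, 1, rfl⟩
  · rw [← act_outFrame κ q]
    exact (isUnitAt_dact_basePt _).2 (by simp)
  · have hpt : act (A * outFrame κ q) basePt = act (outFrame κ q') basePt := by
      rw [act_mul _ _ basePt_pos, act_outFrame, act_outFrame, hq]
    have hA' : act A '' (K ((outFrame κ q).1.col 0)).carrier =
        (K ((outFrame κ q).1.col 0)).carrier := by rwa [col_zero_outFrame]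
    have hcol : (outFrame κ q').1.col 0 = (outFrame κ q).1.col 0 := by
      rw [col_zero_outFrame, col_zero_outFrame]
    rw [← dact_mul_eq_of_act_image_K ht hA' hcol hpt, dact_mul _ _ basePt_pos, act_outFrame]

theorem frameOf_mul_halfTurn (W : SL2C) : frameOf (W * halfTurn) =
    ⟨act W basePt, -dact W basePt ![0, 0, 1], dact W basePt ![0, 1, 0],
      hcross (act W basePt) (-dact W basePt ![0, 0, 1]) (dact W basePt ![0, 1, 0])⟩ := by
  have hpt : act halfTurn basePt = basePt := act_basePt_eq_self_iff.2 halfTurn_unitary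
  have hnormal : dact halfTurn basePt ![0, 0, 1] = -![0, 0, 1] := by
    rw [dact_halfTurn]
    ext k
    fin_cases k <;> simp
  have hdir : dact halfTurn basePt ![0, 1, 0] = ![0, 1, 0] := by
    rw [dact_halfTurn]
    ext k
    fin_cases k <;> simp
  rw [frameOf_eq, act_mul _ _ basePt_pos, dact_mul _ _ basePt_pos, dact_mul _ _ basePt_pos, hpt,
    hnormal, hdir, map_neg]

/-- The spin-decorated horosphere of a nonzero spinor. -/
def spinorDecoration (κ : {κ : Spinor // κ ≠ 0}) : SpinDecoratedHorosphere where
  toHorosphere := spinorHorosphere κ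
  Win q := outFrame κ q * halfTurn
  Wout q := outFrame κ q
  continuous_Win := (continuous_outFrame.comp (f := fun q : (K κ.1).carrier =>
    (⟨(κ, q.1), q.2⟩ : HorosphereBundle)) (by fun_prop)).mul continuous_const
  continuous_Wout := continuous_outFrame.comp (f := fun q : (K κ.1).carrier =>
    (⟨(κ, q.1), q.2⟩ : HorosphereBundle)) (by fun_prop)
  isSpinDecoration := by
    refine ⟨_, isUnitParallel_dact_outFrame κ, fun q =>
      ⟨dact (outFrame κ q) basePt ![0, 0, 1], ?_, ?_, ?_, ?_⟩⟩
    · rw [← act_outFrame κ q]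
      exact (isOutwardNormal_iff (spinorHorosphere_carrier_eq κ q)).2 rfl
    · rw [frameOf_eq, act_outFrame]
    · rw [frameOf_mul_halfTurn, act_outFrame]
    · rw [← act_outFrame κ q, isSpinRotation_pi_iff, inv_mul_cancel_right]

theorem isSpinLift_spinorDecoration : IsSpinLift spinorDecoration where
  carrier_eq _ := rfl
  dir_eq κ q w := by
    have hcol := col_zero_outFrame κ q
    have hdir := mem_K_dir (W := outFrame κ q) (w := w)
    rw [hcol, act_outFrame κ q] at hdir
    exact hdir
  continuous_Wout := continuous_outFrame
  continuous_Win := continuous_outFrame.mul continuous_const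

/-! ### Uniqueness of the lift up to sign -/

theorem continuous_actM_hypBase : Continuous fun A : SL2C => actM A hypBase := by
  have hgInv : Continuous fun A : SL2C => gInv (actM A hypBase) := by
    have hval : Continuous fun A : SL2C => A.1 := continuous_subtype_val
    simp only [gInv_actM_hypBase]
    exact (hval.matrix_mul hval.matrix_conjTranspose).const_smul (1 / 2 : ℂ)
  have hentry (i j) : Continuous fun A : SL2C => gInv (actM A hypBase) i j :=
    hgInv.matrix_elem i j
  refine Continuous.congr (continuous_pi fun k => ?_) fun A => g_gInv (actM A hypBase)
  fin_cases k
  · exact (Complex.continuous_re.comp (hentry 0 0)).add (Complex.continuous_re.comp (hentry 1 1))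
  · exact continuous_const.mul (Complex.continuous_re.comp (hentry 0 1))
  · exact continuous_const.mul (Complex.continuous_im.comp (hentry 0 1))
  · exact (Complex.continuous_re.comp (hentry 0 0)).sub (Complex.continuous_re.comp (hentry 1 1))

theorem continuous_act_basePt : Continuous fun A : SL2C => act A basePt := by
  simp only [act_basePt]
  exact continuous_iff_continuousAt.2 fun A =>
    ContinuousAt.comp (f := fun A : SL2C => actM A hypBase)
      (hasFDerivAt_toUpper (actM_hypBase_mem A)).continuousAt
      continuous_actM_hypBase.continuousAt

theorem continuous_ofSpinor : Continuous ofSpinor := by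
  have hκ (i) : Continuous fun κ : {κ : Spinor // κ ≠ 0} => κ.1 i :=
    (continuous_apply i).comp continuous_subtype_val
  have hnorm : Continuous fun κ : {κ : Spinor // κ ≠ 0} => (spinorNormSq κ.1 : ℂ) := by
    simp only [ofReal_spinorNormSq]
    exact ((hκ 0).mul (hκ 0).star).add ((hκ 1).mul (hκ 1).star)
  have hne (κ : {κ : Spinor // κ ≠ 0}) : (spinorNormSq κ.1 : ℂ) ≠ 0 :=
    Complex.ofReal_ne_zero.2 (spinorNormSq_pos κ.2).ne'
  refine continuous_of_continuous_entries fun i j => ?_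
  fin_cases i <;> fin_cases j
  · exact hκ 0
  · exact (hκ 1).star.neg.div hnorm hne
  · exact hκ 1
  · exact (hκ 0).star.div hnorm hne

theorem continuous_unipotent : Continuous unipotent := by
  refine continuous_of_continuous_entries fun i j => ?_
  fin_cases i <;> fin_cases j
  exacts [continuous_const, continuous_id, continuous_const, continuous_const]

theorem exists_eq_mul_unipotent {A B : SL2C} (hcol : A.1.col 0 = B.1.col 0) :
    ∃ w, A * unipotent w = B := by
  have hone : (A⁻¹ * B).1.col 0 = (1 : SL2C).1.col 0 := by
    rw [col_mul, ← hcol, ← col_mul, inv_mul_cancel]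
  have h00 : (A⁻¹ * B).1 0 0 = 1 := congrFun hone 0
  have h10 : (A⁻¹ * B).1 1 0 = 0 := congrFun hone 1
  have h11 := (A⁻¹ * B).2
  rw [det_fin_two, h00, h10, one_mul, mul_zero, sub_zero] at h11
  refine ⟨(A⁻¹ * B).1 0 1, eq_inv_mul_iff_mul_eq.1 (Subtype.ext ?_)⟩
  ext i j
  fin_cases i <;> fin_cases j
  exacts [h00.symm, rfl, h10.symm, h11.symm]

instance : PreconnectedSpace {κ : Spinor // κ ≠ 0} := by
  have hrank : 1 < Module.rank ℝ Spinor := by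
    have hfinrank : Module.finrank ℝ Spinor = 4 := by
      rw [Module.finrank_pi_fintype]
      simp
    rw [← Module.finrank_eq_rank, hfinrank]
    norm_num
  exact Subtype.preconnectedSpace
    (isConnected_compl_singleton_of_one_lt_rank hrank 0).isPreconnected

instance : PreconnectedSpace SL2C := by
  have hcont : Continuous fun z : {κ : Spinor // κ ≠ 0} × ℂ => ofSpinor z.1 * unipotent z.2 :=
    (continuous_ofSpinor.comp continuous_fst).mul (continuous_unipotent.comp continuous_snd)
  refine Function.Surjective.denseRange (fun W => ?_) |>.preconnectedSpace hcont
  obtain ⟨w, hw⟩ := exists_eq_mul_unipotent (col_zero_ofSpinor ⟨W.1.col 0, col_zero_ne_zero W⟩)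
  exact ⟨(_, w), hw⟩

variable {Kt : {κ : Spinor // κ ≠ 0} → SpinDecoratedHorosphere}

theorem act_basePt_mem_carrier (h : IsSpinLift Kt) {κ : {κ : Spinor // κ ≠ 0}} {W : SL2C}
    (hW : W.1.col 0 = κ.1) : act W basePt ∈ (Kt κ).carrier := by
  rw [h.carrier_eq, ← hW]
  exact act_basePt_mem_K W

/-- The outward spin frame of the lift `Kt` at the base point of `W`, which lies on the horosphere
of the first column of `W`. -/
def liftFrame (h : IsSpinLift Kt) (W : SL2C) : SL2C :=
  (Kt ⟨W.1.col 0, col_zero_ne_zero W⟩).Wout ⟨act W basePt, act_basePt_mem_carrier h rfl⟩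

theorem continuous_liftFrame (h : IsSpinLift Kt) : Continuous (liftFrame h) := by
  have hcol : Continuous fun W : SL2C => W.1.col 0 :=
    continuous_pi fun i =>
      (continuous_subtype_val (X := Matrix (Fin 2) (Fin 2) ℂ)).matrix_elem i 0
  have hpair : Continuous fun W : SL2C =>
      ((⟨W.1.col 0, col_zero_ne_zero W⟩, act W basePt) : {κ : Spinor // κ ≠ 0} × Space) :=
    (hcol.subtype_mk col_zero_ne_zero).prodMk continuous_act_basePt
  exact h.continuous_Wout.comp (hpair.subtype_mk fun _ => act_basePt_mem_carrier h rfl)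

theorem liftFrame_eq_or_eq_neg (h : IsSpinLift Kt) :
    (∀ W, liftFrame h W = W) ∨ ∀ W, liftFrame h W = -W := by
  have hsign (W) : liftFrame h W = W ∨ liftFrame h W = -W :=
    have hκ := col_zero_ne_zero W
    Wout_eq_or_eq_neg ⟨h.carrier_eq ⟨_, hκ⟩, h.dir_eq ⟨_, hκ⟩⟩ rfl
  have hquot (W) : liftFrame h W * W⁻¹ = 1 ∨ liftFrame h W * W⁻¹ = -1 :=
    (hsign W).imp mul_inv_eq_one.2 fun hW => by rw [hW, neg_mul, mul_inv_cancel]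
  have hcont : Continuous fun W => liftFrame h W * W⁻¹ :=
    (continuous_liftFrame h).mul continuous_inv
  have hconst (W) : liftFrame h W = liftFrame h 1 * W := by
    have hW : liftFrame h W * W⁻¹ = liftFrame h 1 * 1⁻¹ :=
      eq_of_eq_one_or_eq_neg_one hcont hquot W 1
    rw [← mul_inv_eq_iff_eq_mul, hW, inv_one, mul_one]
  refine (hsign 1).imp (fun hone W => ?_) fun hone W => ?_
  · rw [hconst, hone, one_mul]
  · rw [hconst, hone, neg_one_mul]

theorem Wout_eq_liftFrame (h : IsSpinLift Kt) {κ : {κ : Spinor // κ ≠ 0}} {W : SL2C}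
    (hW : W.1.col 0 = κ.1) {q : (Kt κ).carrier} (hq : (q : Space) = act W basePt) :
    (Kt κ).Wout q = liftFrame h W := by
  obtain ⟨κ, hκ⟩ := κ
  obtain ⟨q, hq'⟩ := q
  subst hW hq
  rfl

/-! ### Complex lambda lengths -/

variable {κ₁ κ₂ : {κ : Spinor // κ ≠ 0}}

theorem isComplexDistance_neg {A s₁ s₂ : SL2C} {d : ℂ} :
    IsComplexDistance A (-s₁) (-s₂) d ↔ IsComplexDistance A s₁ s₂ d := by
  have hneg : (∃ u, -s₁ = A * torus u) ↔ ∃ u, s₁ = A * torus u :=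
    (Equiv.neg ℂˣ).exists_congr fun u => by
      rw [Equiv.neg_apply, torus_neg, mul_neg, neg_eq_iff_eq_neg]
  rw [isComplexDistance_iff, isComplexDistance_iff, hneg, neg_mul, neg_inj]

theorem isComplexDistance_lift_iff (h : IsSpinLift Kt) {W₁ W₂ : SL2C} (hW₁ : W₁.1.col 0 = κ₁.1)
    (hW₂ : W₂.1.col 0 = κ₂.1) {q₁ : (Kt κ₁).carrier} {q₂ : (Kt κ₂).carrier}
    (hq₁ : (q₁ : Space) = act W₁ basePt) (hq₂ : (q₂ : Space) = act W₂ basePt) {A : SL2C} {d : ℂ} :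
    IsComplexDistance A ((Kt κ₁).Win q₁) ((Kt κ₂).Wout q₂) d ↔
      IsComplexDistance A (W₁ * halfTurn) W₂ d := by
  rw [Win_eq_Wout_mul_halfTurn, Wout_eq_liftFrame h hW₁ hq₁, Wout_eq_liftFrame h hW₂ hq₂]
  rcases liftFrame_eq_or_eq_neg h with h | h
  · rw [h, h]
  · rw [h, h, neg_mul, isComplexDistance_neg]

theorem exp_eq_spinorDet_of_isComplexDistance {A W₁ W₂ : SL2C} {d : ℂ}
    (h : IsComplexDistance A (W₁ * halfTurn) W₂ d) :
    Complex.exp (d / 2) = spinorDet (W₁.1.col 0) (W₂.1.col 0) := by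
  rw [spinorDet_col, (isComplexDistance_iff.1 h).2, mul_assoc, inv_mul_cancel_left, coe_mul,
    expTorus, coe_torus]
  simp [halfTurn, Matrix.mul_apply]

theorem spinorDet_swap (κ κ' : Spinor) : spinorDet κ' κ = -spinorDet κ κ' := by
  rw [spinorDet, spinorDet]
  ring

/-- The outward spin frame of `κ` at the point of its horosphere on the geodesic to the centre of
`κ'`. Its own geodesic runs from the centre of `κ'` to that of `κ`. -/
def joiningFrame {κ κ' : Spinor} (h : spinorDet κ κ' ≠ 0) : SL2C :=
  ⟨!![κ 0, κ' 0 / spinorDet κ κ'; κ 1, κ' 1 / spinorDet κ κ'], by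
    rw [det_fin_two_of]
    field_simp
    rfl⟩

section joiningFrame

variable {κ κ' : Spinor} (h : spinorDet κ κ' ≠ 0) (h' : spinorDet κ' κ ≠ 0)

theorem col_zero_joiningFrame : (joiningFrame h).1.col 0 = κ := by
  ext i
  fin_cases i <;> rfl

theorem actBoundary_joiningFrame_zero :
    actBoundary (joiningFrame h) ((0 : ℂ) : OnePoint ℂ) = spinorBdry κ' := by
  have hscale : spinorBdry ((joiningFrame h).1.col 1) = spinorBdry κ' := by
    simp [joiningFrame, spinorBdry, h, div_div_div_cancel_right₀]
  rw [actBoundary_zero, hscale]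

theorem actBoundary_joiningFrame_infty :
    actBoundary (joiningFrame h) OnePoint.infty = spinorBdry κ := by
  rw [actBoundary_infty, col_zero_joiningFrame]

theorem joiningFrame_mul_halfTurn :
    joiningFrame h * halfTurn = joiningFrame h' * torus (Units.mk0 _ h)⁻¹ := by
  apply Subtype.ext
  rw [coe_mul, coe_mul, coe_torus]
  ext i j
  fin_cases i <;> fin_cases j <;>
    simp [joiningFrame, halfTurn, spinorDet_swap κ κ', Matrix.mul_apply, h, div_eq_mul_inv]

theorem act_joiningFrame_basePt_mem_range_geod :
    act (joiningFrame h) basePt ∈ Set.range (geod (joiningFrame h')) := by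
  rw [← act_basePt_eq_self_iff.2 halfTurn_unitary, ← act_mul _ _ basePt_pos,
    joiningFrame_mul_halfTurn h h']
  exact act_mul_torus_basePt_mem_range_geod _ _

theorem isComplexDistance_joiningFrame :
    IsComplexDistance (joiningFrame h') (joiningFrame h * halfTurn) (joiningFrame h')
      (2 * Complex.log (spinorDet κ κ')) := by
  have htorus : expTorus (2 * Complex.log (spinorDet κ κ')) = torus (Units.mk0 _ h) := by
    refine congrArg torus (Units.ext ?_)
    rw [Units.val_mk0, Units.val_mk0, mul_div_cancel_left₀ _ two_ne_zero, Complex.exp_log h]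
  refine isComplexDistance_iff.2 ⟨⟨_, joiningFrame_mul_halfTurn h h'⟩, ?_⟩
  rw [joiningFrame_mul_halfTurn h h', htorus, mul_assoc, ← map_mul, inv_mul_cancel, map_one,
    mul_one]

end joiningFrame

theorem centre_lift (h : IsSpinLift Kt) (κ : {κ : Spinor // κ ≠ 0}) :
    (Kt κ).centre = spinorBdry κ.1 :=
  centre_eq_spinorBdry κ.2 (h.carrier_eq κ)

theorem centre_lift_eq_iff (h : IsSpinLift Kt) :
    (Kt κ₁).centre = (Kt κ₂).centre ↔ spinorDet κ₁.1 κ₂.1 = 0 := by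
  rw [centre_lift h, centre_lift h, spinorBdry_eq_iff κ₁.2 κ₂.2]

theorem eq_spinorDet_of_isLambdaLength (h : IsSpinLift Kt) {l : ℂ}
    (hl : IsLambdaLength (Kt κ₁) (Kt κ₂) l) : l = spinorDet κ₁.1 κ₂.1 := by
  rcases hl with ⟨hcentre, rfl⟩ | ⟨-, A, -, -, q₁, q₂, -, -, d, hd, rfl⟩
  · exact ((centre_lift_eq_iff h).1 hcentre).symm
  · obtain ⟨W₁, hW₁, hq₁⟩ := (mem_K_carrier κ₁.2).1 ((h.carrier_eq κ₁).subset q₁.2)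
    obtain ⟨W₂, hW₂, hq₂⟩ := (mem_K_carrier κ₂.2).1 ((h.carrier_eq κ₂).subset q₂.2)
    rw [isComplexDistance_lift_iff h hW₁ hW₂ hq₁.symm hq₂.symm] at hd
    rw [exp_eq_spinorDet_of_isComplexDistance hd, hW₁, hW₂]

theorem isLambdaLength_spinorDet (h : IsSpinLift Kt) :
    IsLambdaLength (Kt κ₁) (Kt κ₂) (spinorDet κ₁.1 κ₂.1) := by
  by_cases h₀ : spinorDet κ₁.1 κ₂.1 = 0
  · exact Or.inl ⟨(centre_lift_eq_iff h).2 h₀, h₀⟩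
  have h₀' : spinorDet κ₂.1 κ₁.1 ≠ 0 := by rwa [spinorDet_swap, neg_ne_zero]
  have hW₁ := col_zero_joiningFrame h₀
  have hW₂ := col_zero_joiningFrame h₀'
  refine Or.inr ⟨mt (centre_lift_eq_iff h).1 h₀, joiningFrame h₀', ?_, ?_,
    ⟨_, act_basePt_mem_carrier h hW₁⟩, ⟨_, act_basePt_mem_carrier h hW₂⟩,
    act_joiningFrame_basePt_mem_range_geod h₀ h₀', act_basePt_mem_range_geod _,
    2 * Complex.log (spinorDet κ₁.1 κ₂.1), ?_, ?_⟩
  · rw [actBoundary_joiningFrame_zero, centre_lift h]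
  · rw [actBoundary_joiningFrame_infty, centre_lift h]
  · exact (isComplexDistance_lift_iff h hW₁ hW₂ rfl rfl).2 (isComplexDistance_joiningFrame h₀ h₀')
  · rw [mul_div_cancel_left₀ _ two_ne_zero, Complex.exp_log h₀]

theorem isLambdaLength_lift_iff (h : IsSpinLift Kt) (κ₁ κ₂ : {κ : Spinor // κ ≠ 0}) (l : ℂ) :
    IsLambdaLength (Kt κ₁) (Kt κ₂) l ↔ l = spinorDet κ₁.1 κ₂.1 :=
  ⟨eq_spinorDet_of_isLambdaLength h, fun hl => hl ▸ isLambdaLength_spinorDet h⟩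

end

end SpinHoro

theorem theorem1p3 :
    (∃ Kt : {κ : SpinHoro.Spinor // κ ≠ 0} → SpinHoro.SpinDecoratedHorosphere,
      SpinHoro.IsSpinLift Kt) ∧
    ∀ Kt : {κ : SpinHoro.Spinor // κ ≠ 0} → SpinHoro.SpinDecoratedHorosphere,
      SpinHoro.IsSpinLift Kt →
      ∀ (κ₁ κ₂ : {κ : SpinHoro.Spinor // κ ≠ 0}) (l : ℂ),
        SpinHoro.IsLambdaLength (Kt κ₁) (Kt κ₂) l ↔ l = SpinHoro.spinorDet κ₁.1 κ₂.1 :=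
  ⟨⟨_, SpinHoro.isSpinLift_spinorDecoration⟩, fun _ h => SpinHoro.isLambdaLength_lift_iff h⟩
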